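/- Let $d\in\mathbb N$, let $M=\mathbb R^d$ or $M=\mathbb T^d=\mathbb R^d/2\pi\mathbb Z^d$, and let $r\in[1,\infty)$. Equip the cotangent bundle $T^*M=M\times\mathbb R^d$, with canonical coordinates $(q,p)$, with its standard symplectic form $\sum_{i=1}^d dp_i\wedge dq_i$ and its standard volume $\mathrm{Vol}$. A Hamiltonian diffeomorphism of $T^*M$ is the time-one map $\Phi=\varphi^1$ of a smooth isotopy $(\varphi^t)_{t\in\mathbb R}$ of diffeomorphisms of $T^*M$ with $\varphi^0=\mathrm{id}$ for which there is a smooth time-dependent Hamiltonian $H:\mathbb R\times T^*M\to\mathbb R$ such that every curve $t\mapsto\varphi^t(x)$ solves Hamilton's equations $\dot q=\nabla_pH(t,q,p)$, $\dot p=-\nabla_qH(t,q,p)$. Let $\mathrm{DHam}(T^*M)$ be the set of all Hamiltonian diffeomorphisms and, for $\rho_0\in L^r(T^*M)=L^r(T^*M,\mathbb R)$, let $$\mathcal O(\rho_0)=\{\rho_0\circ\Phi\mid\Phi\in\mathrm{DHam}(T^*M)\}.$$ Then, for every $\rho_0\in L^r(T^*M)$, $$\overline{\mathcal O(\rho_0)}=\bigl\{\rho_1\in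 L^r(T^*M)\ \big|\ \mathrm{Vol}(\{\mu<\rho_1<\nu\})=\mathrm{Vol}(\{\mu<\rho_0<\nu\})\text{ for all real }\mu<\nu\bigr\},$$ where the closure is taken in the $L^r$-topology. -/

import Mathlib

open MeasureTheory
open scoped ENNReal ContDiff

noncomputable section

instance fact_two_pi_pos : Fact (0 < 2 * Real.pi) := ⟨Real.two_pi_pos⟩

/-- The torus `𝕋ᵈ = ℝᵈ / 2πℤᵈ`. -/
abbrev Torus (d : ℕ) : Type := Fin d → AddCircle (2 * Real.pi)

/-- The phase space `T*ℝᵈ`, with its canonical coordinates: a point is `(q, p)`. Its volume is the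
Lebesgue measure (the canonical volume form, up to the constant factor `d!`). -/
abbrev CotEuclidean (d : ℕ) : Type := (Fin d → ℝ) × (Fin d → ℝ)

/-- The phase space `T*𝕋ᵈ = 𝕋ᵈ × ℝᵈ`: a point is `(q, p)`. Its volume is the product of the Haar
measure on the torus with total mass `(2π)ᵈ` and the Lebesgue measure. -/
abbrev CotTorus (d : ℕ) : Type := Torus d × (Fin d → ℝ)

/-- The universal covering `T*ℝᵈ → T*𝕋ᵈ`, `(q, p) ↦ (q mod 2π, p)`. -/
def torusCover (d : ℕ) (z : CotEuclidean d) : CotTorus d :=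
  (fun i => (z.1 i : AddCircle (2 * Real.pi)), z.2)

/-- The Hamiltonian vector field `(∂h/∂p, -∂h/∂q)` of a function `h` on `T*ℝᵈ`. -/
def hamiltonianVectorField {d : ℕ} (h : CotEuclidean d → ℝ) (z : CotEuclidean d) :
    CotEuclidean d :=
  (fun i => fderiv ℝ h z (0, Pi.single i 1), fun i => -fderiv ℝ h z (Pi.single i 1, 0))

/-- Smoothness of a map `F : X → X`, where `X` carries the smooth structure for which
`π : T*ℝᵈ → X` is the universal covering (the identity for `X = T*ℝᵈ`, reduction mod `2π` of the
positions for `X = T*𝕋ᵈ`): `F` is smooth if and only if it has a smooth lift to `T*ℝᵈ`. -/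
def IsSmoothMap {d : ℕ} {X : Type} (π : CotEuclidean d → X) (F : X → X) : Prop :=
  ∃ G : CotEuclidean d → CotEuclidean d, ContDiff ℝ ∞ G ∧ ∀ z, π (G z) = F (π z)

/-- `F` is a (smooth) diffeomorphism of `X`. -/
def IsDiffeo {d : ℕ} {X : Type} (π : CotEuclidean d → X) (F : X → X) : Prop :=
  IsSmoothMap π F ∧
    ∃ F' : X → X, IsSmoothMap π F' ∧ Function.LeftInverse F' F ∧ Function.RightInverse F' F

/-- `φ` is a smooth isotopy of `X`, starting at the identity, that is generated by the
time-dependent Hamiltonian `H`. Since `π` is a local symplectomorphism, Hamilton's equations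
`q' = ∂H/∂p`, `p' = -∂H/∂q` for the curves `t ↦ φ t x` are written for their lifts to `T*ℝᵈ`. -/
structure IsHamiltonianIsotopy {d : ℕ} {X : Type} (π : CotEuclidean d → X)
    (H : ℝ → X → ℝ) (φ : ℝ → X → X) : Prop where
  smooth_hamiltonian : ContDiff ℝ ∞ fun y : ℝ × CotEuclidean d => H y.1 (π y.2)
  isDiffeo : ∀ t, IsDiffeo π (φ t)
  start : φ 0 = id
  flow : ∃ G : ℝ → CotEuclidean d → CotEuclidean d,
    ContDiff ℝ ∞ (fun y : ℝ × CotEuclidean d => G y.1 y.2) ∧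
    (∀ t z, π (G t z) = φ t (π z)) ∧
    ∀ t z, HasDerivAt (fun s => G s z)
      (hamiltonianVectorField (fun w => H t (π w)) (G t z)) t

/-- The Hamiltonian diffeomorphisms of `X`: the time-one maps of the isotopies generated by smooth
time-dependent Hamiltonians. -/
def DHam {d : ℕ} {X : Type} (π : CotEuclidean d → X) : Set (X → X) :=
  {Φ | ∃ (H : ℝ → X → ℝ) (φ : ℝ → X → X), IsHamiltonianIsotopy π H φ ∧ φ 1 = Φ}

/-- The orbit `{ρ₀ ∘ Φ | Φ a Hamiltonian diffeomorphism}` in `Lʳ(X)`. -/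
def orbit {d : ℕ} {X : Type} [MeasureSpace X] (π : CotEuclidean d → X) {r : ℝ≥0∞}
    (ρ₀ : Lp ℝ r (volume : Measure X)) : Set (Lp ℝ r (volume : Measure X)) :=
  {ρ | ∃ Φ ∈ DHam π, (ρ : X → ℝ) =ᵐ[volume] fun x => ρ₀ (Φ x)}

end

/-!
Every function in the closure of the orbit of `ρ₀` is equimeasurable with `ρ₀`: by
Liouville's theorem (`abs_det_fderiv_flow`, transported to the quotient by a fundamental domain in
`DHam.measurePreserving`) Hamiltonian diffeomorphisms preserve the volume, and the volumes of the
sets `{μ < ρ < ν}` pass to limits in measure (`equimeasurable_of_mem_closure_orbit`).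

For the converse, phase space is divided into the cells of a fine grid `c × c'` in positions and
momenta. A Hamiltonian that depends on the momenta only has as its time-one map a shear that
translates the positions, and vice versa. The shears are allowed to become steep near the boundary
of the cells: cutting off a linear Hamiltonian outside one cell of the momenta gives diffeomorphisms
which converge almost everywhere to the translation of one row of cells. Composition with measure
preserving maps is continuous in `Lʳ` under such convergence, so that the translations of rows and
of columns are limits of Hamiltonian diffeomorphisms (`IsOrbitLimit`). A row and a column meet in a
single cell, hence the commutator of their translations is a 3-cycle of cells. Since there are
infinitely many rows, the 3-cycles realize all injections of finite sets of cells
(`exists_mem_eq_of_injOn`, `exists_isOrbitLimit_of_injOn`).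

Finally, equimeasurable functions `ρ₀`, `ρ₁` are rounded to multiples of `1 / n` (`quantize`). The
rounded functions have the same distribution away from `0`, and on a fine grid they are constant on
cells, up to a set of small volume (`exists_label_of_fine`). Matching the cells value by value and
permuting them accordingly carries the one function to the other up to a set of small volume
(`exists_rearrangement`), and therefore `ρ₀` to within `ε` of `ρ₁`.

The two phase spaces are treated together as `Yᵈ × ℝᵈ` with a covering `κ : ℝ → Y` (`phaseCover`),
for which only the existence of fine grids (`IsGrid`) has to be known. The case `d = 0`, where phase
space is a point, is separate.
-/

noncomputable section

open Filter Topology Set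
open scoped symmDiff

/-! ### Liouville's theorem -/

/-- The canonical symplectic form on `T*ℝᵈ`, as a bilinear form:
`ω(a, b) = ∑ (a_p b_q - a_q b_p)`. -/
def symplecticForm (d : ℕ) : LinearMap.BilinForm ℝ (CotEuclidean d) :=
  LinearMap.mk₂ ℝ (fun a b => ∑ i, (a.2 i * b.1 i - a.1 i * b.2 i))
    (fun a a' b => by
      rw [← Finset.sum_add_distrib]
      exact Finset.sum_congr rfl fun i _ => by
        simp only [Prod.fst_add, Prod.snd_add, Pi.add_apply]; ring)
    (fun c a b => by
      rw [smul_eq_mul, Finset.mul_sum]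
      exact Finset.sum_congr rfl fun i _ => by
        simp only [Prod.smul_fst, Prod.smul_snd, Pi.smul_apply, smul_eq_mul]; ring)
    (fun a b b' => by
      rw [← Finset.sum_add_distrib]
      exact Finset.sum_congr rfl fun i _ => by
        simp only [Prod.fst_add, Prod.snd_add, Pi.add_apply]; ring)
    (fun c a b => by
      rw [smul_eq_mul, Finset.mul_sum]
      exact Finset.sum_congr rfl fun i _ => by
        simp only [Prod.smul_fst, Prod.smul_snd, Pi.smul_apply, smul_eq_mul]; ring)

theorem symplecticForm_apply {d : ℕ} (a b : CotEuclidean d) :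
    symplecticForm d a b = ∑ i, (a.2 i * b.1 i - a.1 i * b.2 i) := rfl

theorem symplecticForm_neg {d : ℕ} (a b : CotEuclidean d) :
    symplecticForm d a b = -symplecticForm d b a := by
  rw [symplecticForm_apply, symplecticForm_apply, ← Finset.sum_neg_distrib]
  exact Finset.sum_congr rfl fun i _ => by ring

theorem symplecticForm_nondegenerate (d : ℕ) : (symplecticForm d).Nondegenerate := by
  have key : ∀ a, (∀ b, symplecticForm d a b = 0) → a = 0 := by
    intro a ha
    ext i
    · have := ha (0, Pi.single i 1)
      simpa [symplecticForm_apply, Pi.single_apply] using this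
    · have := ha (Pi.single i 1, 0)
      simpa [symplecticForm_apply, Pi.single_apply] using this
  refine ⟨key, fun b hb => key b fun a => ?_⟩
  rw [symplecticForm_neg, hb, neg_zero]

/-- A vector of `T*ℝᵈ` in terms of the canonical basis. -/
theorem cotEuclidean_eq_sum {d : ℕ} (b : CotEuclidean d) :
    b = ∑ i, (b.1 i • ((Pi.single i 1, 0) : CotEuclidean d)
      + b.2 i • ((0, Pi.single i 1) : CotEuclidean d)) := by
  ext j
  · simp [Prod.fst_sum, Finset.sum_apply, Pi.single_apply]
  · simp [Prod.snd_sum, Finset.sum_apply, Pi.single_apply]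

/-- The Hamiltonian vector field is the symplectic gradient. -/
theorem symplecticForm_hamiltonianVectorField {d : ℕ} (h : CotEuclidean d → ℝ)
    (z b : CotEuclidean d) :
    symplecticForm d (hamiltonianVectorField h z) b = -fderiv ℝ h z b := by
  conv_rhs => rw [cotEuclidean_eq_sum b, map_sum, ← Finset.sum_neg_distrib]
  rw [symplecticForm_apply]
  refine Finset.sum_congr rfl fun i _ => ?_
  rw [map_add, map_smul, map_smul]
  simp only [hamiltonianVectorField, smul_eq_mul]
  ring

theorem contDiff_hamiltonianVectorField {d : ℕ} {h : CotEuclidean d → ℝ} (hh : ContDiff ℝ ∞ h) :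
    ContDiff ℝ ∞ (hamiltonianVectorField h) := by
  have hD : ContDiff ℝ ∞ (fderiv ℝ h) := hh.fderiv_right (by simp)
  refine ContDiff.prodMk ?_ ?_
  · exact contDiff_pi.2 fun i => hD.clm_apply contDiff_const
  · exact contDiff_pi.2 fun i => (hD.clm_apply contDiff_const).neg

/-- Hamiltonian vector fields are infinitesimally symplectic: contracting the derivative with the
symplectic form gives minus the Hessian, which is symmetric. -/
theorem symplecticForm_fderiv_hamiltonianVectorField {d : ℕ} {h : CotEuclidean d → ℝ}
    (hh : ContDiff ℝ ∞ h) (z u b : CotEuclidean d) :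
    symplecticForm d (fderiv ℝ (hamiltonianVectorField h) z u) b
      = -fderiv ℝ (fderiv ℝ h) z u b := by
  have hX := (contDiff_hamiltonianVectorField hh).differentiable (by simp) z
  have hD : ContDiff ℝ ∞ (fderiv ℝ h) := hh.fderiv_right (by simp)
  set l : CotEuclidean d →L[ℝ] ℝ := ((symplecticForm d).flip b).toContinuousLinearMap
  have e : (fun w => l (hamiltonianVectorField h w)) = fun w => -fderiv ℝ h w b := by
    funext w; exact symplecticForm_hamiltonianVectorField h w b
  have h1 := (l.hasFDerivAt.comp z hX.hasFDerivAt)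
  have h2 := ((hD.differentiable (by simp) z).hasFDerivAt.clm_apply (hasFDerivAt_const b z)).neg
  have h4 : HasFDerivAt (fun w => -fderiv ℝ h w b)
      (l.comp (fderiv ℝ (hamiltonianVectorField h) z)) z := by
    rw [← e]; exact h1
  have h5 := congrArg (fun L => L u) (h4.unique h2)
  simpa [l] using h5

theorem symplecticForm_fderiv_symm {d : ℕ} {h : CotEuclidean d → ℝ}
    (hh : ContDiff ℝ ∞ h) (z u v : CotEuclidean d) :
    symplecticForm d (fderiv ℝ (hamiltonianVectorField h) z u) v
      + symplecticForm d u (fderiv ℝ (hamiltonianVectorField h) z v) = 0 := by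
  rw [symplecticForm_neg u, symplecticForm_fderiv_hamiltonianVectorField hh,
    symplecticForm_fderiv_hamiltonianVectorField hh]
  have := (hh.contDiffAt (x := z)).isSymmSndFDerivAt
    (by simpa using WithTop.coe_le_coe.2 (le_top : (2 : ℕ∞) ≤ ⊤))
  rw [this.eq u v]; ring

/-- The variational equation along a Hamiltonian flow. -/
theorem hasDerivAt_fderiv_flow {d : ℕ} {X : ℝ → CotEuclidean d → CotEuclidean d}
    {G : ℝ → CotEuclidean d → CotEuclidean d} (hX : ∀ t, ContDiff ℝ ∞ (X t))
    (hG : ContDiff ℝ ∞ fun y : ℝ × CotEuclidean d => G y.1 y.2)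
    (hflow : ∀ t z, HasDerivAt (fun s => G s z) (X t (G t z)) t) (t : ℝ) (z a : CotEuclidean d) :
    HasDerivAt (fun s => fderiv ℝ (G s) z a) (fderiv ℝ (X t) (G t z) (fderiv ℝ (G t) z a)) t := by
  set F : ℝ × CotEuclidean d → CotEuclidean d := fun y => G y.1 y.2
  have hF : ∀ y, HasFDerivAt F (fderiv ℝ F y) y := fun y =>
    (hG.differentiable (by simp) y).hasFDerivAt
  have hDF : ContDiff ℝ ∞ (fderiv ℝ F) := hG.fderiv_right (by simp)
  have hD : ∀ y, HasFDerivAt (fderiv ℝ F) (fderiv ℝ (fderiv ℝ F) y) y := fun y =>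
    (hDF.differentiable (by simp) y).hasFDerivAt
  have hz : ∀ s w, HasFDerivAt (G s) ((fderiv ℝ F (s, w)).comp (.inr ℝ ℝ (CotEuclidean d))) w :=
    fun s w => (hF (s, w)).comp w (hasFDerivAt_prodMk_right s w)
  have ht : ∀ s w, fderiv ℝ F (s, w) (1, 0) = X s (G s w) := by
    intro s w
    have h1 := ((hF (s, w)).comp s (hasFDerivAt_prodMk_left s w)).hasDerivAt
    have h2 := h1.unique (hflow s w)
    simpa using h2
  have e1 : (fun s => fderiv ℝ (G s) z a) = fun s => fderiv ℝ F (s, z) (0, a) := by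
    funext s; rw [(hz s z).fderiv]; simp
  have e2 : fderiv ℝ (X t) (G t z) (fderiv ℝ (G t) z a)
      = fderiv ℝ (fderiv ℝ F) (t, z) (0, a) (1, 0) := by
    have hx := ((hX t).differentiable (by simp) (G t z)).hasFDerivAt.comp z (hz t z)
    have h1 := ((hD (t, z)).comp z (hasFDerivAt_prodMk_right t z)).clm_apply
      (hasFDerivAt_const ((1, 0) : ℝ × CotEuclidean d) z)
    have h2 : HasFDerivAt (X t ∘ G t) _ z := h1.congr_of_eventuallyEq
      (Eventually.of_forall fun w => (ht t w).symm)
    have h3 := congrArg (fun L => L a) (hx.unique h2)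
    rw [(hz t z).fderiv]
    simpa using h3
  have h0 : HasFDerivAt (fun s => fderiv ℝ F (s, z)) _ t :=
    (hD (t, z)).comp t (hasFDerivAt_prodMk_left t z)
  have h1 := (h0.clm_apply (hasFDerivAt_const ((0, a) : ℝ × CotEuclidean d) t)).hasDerivAt
  rw [e1, e2]
  have hs := ((hG.contDiffAt (x := (t, z))).isSymmSndFDerivAt
    (by simpa using WithTop.coe_le_coe.2 (le_top : (2 : ℕ∞) ≤ ⊤))).eq (1, 0) (0, a)
  rw [← hs]
  simpa using h1

/-- Liouville: the derivative of a Hamiltonian flow is symplectic, hence has determinant `±1`. -/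
theorem abs_det_fderiv_flow {d : ℕ} {h : ℝ → CotEuclidean d → ℝ}
    {G : ℝ → CotEuclidean d → CotEuclidean d} (hh : ∀ t, ContDiff ℝ ∞ (h t))
    (hG : ContDiff ℝ ∞ fun y : ℝ × CotEuclidean d => G y.1 y.2) (hG0 : ∀ z, G 0 z = z)
    (hflow : ∀ t z, HasDerivAt (fun s => G s z) (hamiltonianVectorField (h t) (G t z)) t)
    (t : ℝ) (z : CotEuclidean d) : |(fderiv ℝ (G t) z).det| = 1 := by
  have hvar := fun t a => hasDerivAt_fderiv_flow
    (fun t => contDiff_hamiltonianVectorField (hh t)) hG hflow t z a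
  set B : CotEuclidean d →L[ℝ] CotEuclidean d →L[ℝ] ℝ :=
    LinearMap.toContinuousLinearMap
      (LinearMap.toContinuousLinearMap.toLinearMap.comp (symplecticForm d)) with hB
  have hBa : ∀ a b, B a b = symplecticForm d a b := fun a b => rfl
  have hconst : ∀ a b t, symplecticForm d (fderiv ℝ (G t) z a) (fderiv ℝ (G t) z b)
      = symplecticForm d a b := by
    intro a b t
    have hd : ∀ t, HasDerivAt (fun t => B (fderiv ℝ (G t) z a) (fderiv ℝ (G t) z b)) 0 t := by
      intro t
      have h1 := ((B.hasFDerivAt.comp_hasDerivAt t (hvar t a)).clm_apply (hvar t b))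
      refine h1.congr_deriv ?_
      exact symplecticForm_fderiv_symm (hh t) _ _ _
    have := is_const_of_deriv_eq_zero (fun t => (hd t).differentiableAt) (fun t => (hd t).deriv) t 0
    simp only [hBa] at this
    rw [this]
    have : G 0 = id := funext hG0
    simp [this]
  set M : CotEuclidean d →ₗ[ℝ] CotEuclidean d := (fderiv ℝ (G t) z).toLinearMap
  have hM : (symplecticForm d).comp M M = symplecticForm d := by
    ext a b <;> exact hconst _ _ t
  let b := Module.finBasis ℝ (CotEuclidean d)
  have h1 := LinearMap.BilinForm.toMatrix_comp b b (symplecticForm d) M M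
  rw [hM] at h1
  have h2 := congrArg Matrix.det h1
  have h3 : (LinearMap.BilinForm.toMatrix b (symplecticForm d)).det ≠ 0 :=
    (LinearMap.BilinForm.nondegenerate_iff_det_ne_zero b).1 (symplecticForm_nondegenerate d)
  rw [Matrix.det_mul, Matrix.det_mul, Matrix.det_transpose, LinearMap.det_toMatrix] at h2
  have h4 : LinearMap.det M * LinearMap.det M = 1 := by
    apply mul_right_cancel₀ h3
    linear_combination -h2
  change |LinearMap.det M| = 1
  rcases mul_self_eq_one_iff.1 h4 with h | h <;> simp [h]

/-! ### Composition and volume preservation of Hamiltonian diffeomorphisms -/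

/-- `π` presents `X` as the quotient of `T*ℝᵈ` by the countable group `ker π`, and `D` is a strict
fundamental domain from which `X` inherits its volume. -/
structure IsPhaseCover {d : ℕ} {X : Type} [AddCommGroup X] [TopologicalSpace X] [MeasureSpace X]
    (π : CotEuclidean d →+ X) (D : Set (CotEuclidean d)) : Prop where
  isOpenQuotientMap : IsOpenQuotientMap π
  countable_ker : (π.ker : Set (CotEuclidean d)).Countable
  measurableSet : MeasurableSet D
  existsUnique_vadd_mem : ∀ z, ∃! γ : π.ker, γ +ᵥ z ∈ D
  measurePreserving : MeasurePreserving π (volume.restrict D) volume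

section Flow

variable {d : ℕ} {X : Type} [AddCommGroup X] {π : CotEuclidean d →+ X}

theorem hamiltonianVectorField_add_ker (f : X → ℝ) {γ : CotEuclidean d} (hγ : γ ∈ π.ker)
    (z : CotEuclidean d) :
    hamiltonianVectorField (fun w => f (π w)) (z + γ)
      = hamiltonianVectorField (fun w => f (π w)) z := by
  have e : (fun w => f (π w)) = fun w => f (π (w + γ)) := by
    funext w; rw [map_add, AddMonoidHom.mem_ker.1 hγ, add_zero]
  have h : fderiv ℝ (fun w => f (π w)) (z + γ) = fderiv ℝ (fun w => f (π w)) z := by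
    conv_rhs => rw [e]
    exact (fderiv_comp_add_right (f := fun w => f (π w)) γ).symm
  simp only [hamiltonianVectorField, h]

/-- The lift of a Hamiltonian isotopy can be chosen to start at the identity: a lift of the
identity differs from the identity by a continuous map into the countable group `ker π`. -/
theorem IsHamiltonianIsotopy.exists_lift (hc : (π.ker : Set (CotEuclidean d)).Countable)
    {H : ℝ → X → ℝ} {φ : ℝ → X → X} (h : IsHamiltonianIsotopy π H φ) :
    ∃ G : ℝ → CotEuclidean d → CotEuclidean d,
      ContDiff ℝ ∞ (fun y : ℝ × CotEuclidean d => G y.1 y.2) ∧ (∀ z, G 0 z = z) ∧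
      (∀ t z, π (G t z) = φ t (π z)) ∧
      ∀ t z, HasDerivAt (fun s => G s z)
        (hamiltonianVectorField (fun w => H t (π w)) (G t z)) t := by
  obtain ⟨G, hG, hπ, hflow⟩ := h.flow
  have hker : ∀ z, G 0 z - z ∈ π.ker := fun z => by
    rw [AddMonoidHom.mem_ker, map_sub, hπ, h.start, id, sub_self]
  have hcont : Continuous fun z => G 0 z - z :=
    (hG.continuous.comp (continuous_const.prodMk continuous_id)).sub continuous_id
  have hconst : ∀ z, G 0 z - z = G 0 0 - 0 := fun z =>
    hc.isTotallyDisconnected _ (range_subset_iff.2 hker) (isPreconnected_range hcont)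
      (mem_range_self z) (mem_range_self 0)
  set γ : CotEuclidean d := G 0 0 - 0
  have hγ : γ ∈ π.ker := hker 0
  refine ⟨fun t z => G t z + -γ, hG.add contDiff_const, fun z => ?_, fun t z => ?_, fun t z => ?_⟩
  · rw [← hconst z, neg_sub]; exact add_sub_cancel _ _
  · rw [map_add, map_neg, AddMonoidHom.mem_ker.1 hγ, neg_zero, add_zero, hπ]
  · rw [hamiltonianVectorField_add_ker _ (neg_mem hγ)]
    exact (hflow t z).add_const _

theorem IsSmoothMap.comp {F F' : X → X} (h : IsSmoothMap π F) (h' : IsSmoothMap π F') :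
    IsSmoothMap π (F ∘ F') := by
  obtain ⟨G, hG, e⟩ := h
  obtain ⟨G', hG', e'⟩ := h'
  exact ⟨G ∘ G', hG.comp hG', fun z => by simp only [Function.comp_apply, e, e']⟩

theorem IsDiffeo.comp {F F' : X → X} (h : IsDiffeo π F) (h' : IsDiffeo π F') :
    IsDiffeo π (F ∘ F') := by
  obtain ⟨hF, I, hI, hl, hr⟩ := h
  obtain ⟨hF', I', hI', hl', hr'⟩ := h'
  exact ⟨hF.comp hF', I' ∘ I, hI'.comp hI, hl.comp hl', hr.comp hr'⟩

/-- Hamiltonian diffeomorphisms are closed under composition. The two isotopies are run one after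
the other, each reparametrised in time so that it rests near the switching time. -/
theorem DHam.comp (hc : (π.ker : Set (CotEuclidean d)).Countable) {Φ Ψ : X → X}
    (hΦ : Φ ∈ DHam π) (hΨ : Ψ ∈ DHam π) : Φ ∘ Ψ ∈ DHam π := by
  obtain ⟨H, φ, h, rfl⟩ := hΦ
  obtain ⟨K, ψ, k, rfl⟩ := hΨ
  obtain ⟨G, hG, hG0, hGπ, hGflow⟩ := h.exists_lift hc
  obtain ⟨L, hL, -, hLπ, hLflow⟩ := k.exists_lift hc
  let a : ℝ → ℝ := fun t => Real.smoothTransition (3 * t)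
  let b : ℝ → ℝ := fun t => Real.smoothTransition (3 * t - 2)
  have ha : ContDiff ℝ ∞ a := Real.smoothTransition.contDiff.comp (contDiff_const.mul contDiff_id)
  have hb : ContDiff ℝ ∞ b :=
    Real.smoothTransition.contDiff.comp ((contDiff_const.mul contDiff_id).sub contDiff_const)
  have ha' : ContDiff ℝ ∞ (deriv a) := (contDiff_infty_iff_deriv.1 ha).2
  have hb' : ContDiff ℝ ∞ (deriv b) := (contDiff_infty_iff_deriv.1 hb).2
  have hda : ∀ t, HasDerivAt a (deriv a t) t := fun t => (ha.differentiable (by simp) t).hasDerivAt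
  have hdb : ∀ t, HasDerivAt b (deriv b t) t := fun t => (hb.differentiable (by simp) t).hasDerivAt
  have ha1 : ∀ t, 1 / 3 < t → a t = 1 := fun t ht =>
    Real.smoothTransition.one_of_one_le (by linarith)
  have hb0 : ∀ t, t < 2 / 3 → b t = 0 := fun t ht =>
    Real.smoothTransition.zero_of_nonpos (by linarith)
  have ha1' : ∀ t, 1 / 3 < t → deriv a t = 0 := fun t ht => by
    have : a =ᶠ[𝓝 t] fun _ => 1 := by filter_upwards [lt_mem_nhds ht] with s hs using ha1 s hs
    rw [this.deriv_eq, deriv_const]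
  have hb0' : ∀ t, t < 2 / 3 → deriv b t = 0 := fun t ht => by
    have : b =ᶠ[𝓝 t] fun _ => 0 := by filter_upwards [gt_mem_nhds ht] with s hs using hb0 s hs
    rw [this.deriv_eq, deriv_const]
  have hsc : ∀ (c : ℝ) (f : CotEuclidean d → ℝ), Differentiable ℝ f → ∀ z,
      hamiltonianVectorField (fun w => c * f w) z = c • hamiltonianVectorField f z := by
    intro c f hf z
    have : fderiv ℝ (fun w => c * f w) z = c • fderiv ℝ f z := fderiv_const_mul (hf z) c
    ext i <;> simp [hamiltonianVectorField, this]
  have hHd : ∀ t, Differentiable ℝ fun w => H t (π w) := fun t =>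
    (h.smooth_hamiltonian.comp (contDiff_const.prodMk contDiff_id :
      ContDiff ℝ ∞ fun w : CotEuclidean d => (t, w))).differentiable (by simp)
  have hKd : ∀ t, Differentiable ℝ fun w => K t (π w) := fun t =>
    (k.smooth_hamiltonian.comp (contDiff_const.prodMk contDiff_id :
      ContDiff ℝ ∞ fun w : CotEuclidean d => (t, w))).differentiable (by simp)
  refine ⟨fun t x => deriv a t * K (a t) x + deriv b t * H (b t) x,
    fun t => φ (b t) ∘ ψ (a t), ⟨?_, fun t => (h.isDiffeo _).comp (k.isDiffeo _), ?_,
    fun t z => G (b t) (L (a t) z), ?_, ?_, ?_⟩, ?_⟩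
  · refine ContDiff.add ?_ ?_
    · exact (ha'.comp contDiff_fst).mul
        (k.smooth_hamiltonian.comp ((ha.comp contDiff_fst).prodMk contDiff_snd))
    · exact (hb'.comp contDiff_fst).mul
        (h.smooth_hamiltonian.comp ((hb.comp contDiff_fst).prodMk contDiff_snd))
  · have e1 : a 0 = 0 := Real.smoothTransition.zero_of_nonpos (by norm_num)
    simp only [e1, hb0 0 (by norm_num), h.start, k.start, Function.comp_id]
  · exact hG.comp ((hb.comp contDiff_fst).prodMk
      (hL.comp ((ha.comp contDiff_fst).prodMk contDiff_snd)))
  · intro t z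
    rw [hGπ, hLπ, Function.comp_apply]
  · intro t z
    rcases lt_or_ge t (2 / 3) with ht | ht
    · have e : (fun s => G (b s) (L (a s) z)) =ᶠ[𝓝 t] fun s => L (a s) z := by
        filter_upwards [gt_mem_nhds ht] with s hs
        rw [hb0 s hs, hG0]
      refine HasDerivAt.congr_of_eventuallyEq ?_ e
      simp only [hb0 t ht, hb0' t ht, hG0, zero_mul, add_zero]
      rw [hsc _ _ (hKd _)]
      exact (hLflow (a t) z).scomp t (hda t)
    · have ht' : 1 / 3 < t := by linarith
      have e : (fun s => G (b s) (L (a s) z)) =ᶠ[𝓝 t] fun s => G (b s) (L 1 z) := by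
        filter_upwards [lt_mem_nhds ht'] with s hs
        rw [ha1 s hs]
      refine HasDerivAt.congr_of_eventuallyEq ?_ e
      simp only [ha1 t ht', ha1' t ht', zero_mul, zero_add]
      rw [hsc _ _ (hHd _)]
      exact (hGflow (b t) (L 1 z)).scomp t (hdb t)
  · have e1 : b 1 = 1 := Real.smoothTransition.one_of_one_le (by norm_num)
    simp only [e1, ha1 1 (by norm_num)]

end Flow

/-- Hamiltonian diffeomorphisms preserve the volume: a lift maps the fundamental domain
injectively, with Jacobian `±1`, onto another fundamental domain. -/
theorem DHam.measurePreserving {d : ℕ} {X : Type} [AddCommGroup X] [TopologicalSpace X]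
    [MeasureSpace X] [BorelSpace X] {π : CotEuclidean d →+ X} {D : Set (CotEuclidean d)}
    (hD : IsPhaseCover π D) {Φ : X → X} (hΦ : Φ ∈ DHam π) :
    MeasurePreserving Φ := by
  obtain ⟨H, φ, h, rfl⟩ := hΦ
  obtain ⟨G, hG, hG0, hGπ, hGflow⟩ := h.exists_lift hD.countable_ker
  have hdet := abs_det_fderiv_flow (h := fun t w => H t (π w)) (fun t =>
    h.smooth_hamiltonian.comp (contDiff_const.prodMk contDiff_id :
      ContDiff ℝ ∞ fun w : CotEuclidean d => (t, w))) hG hG0 hGflow 1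
  have hG1 : ContDiff ℝ ∞ (G 1) := hG.comp (contDiff_const.prodMk contDiff_id)
  obtain ⟨-, I, -, hIl, hIr⟩ := h.isDiffeo 1
  have hφc : Continuous (φ 1) := by
    rw [hD.isOpenQuotientMap.isQuotientMap.continuous_iff]
    have : φ 1 ∘ π = π ∘ G 1 := funext fun z => (hGπ 1 z).symm
    rw [this]
    exact hD.isOpenQuotientMap.continuous.comp hG1.continuous
  have hπm : Measurable π := hD.isOpenQuotientMap.continuous.measurable
  have : (volume : Measure (CotEuclidean d)).IsAddHaarMeasure :=
    Measure.prod.instIsAddHaarMeasure volume volume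
  have : VAddInvariantMeasure π.ker (CotEuclidean d) volume :=
    ⟨fun γ s _ => measure_preimage_add volume (γ : CotEuclidean d) s⟩
  have : Countable π.ker := hD.countable_ker.to_subtype
  -- two points of `D` with the same image in `X` coincide
  have hDinj : ∀ z ∈ D, ∀ w ∈ D, π z = π w → z = w := by
    intro z hz w hw e
    have hk : w - z ∈ π.ker := by rw [AddMonoidHom.mem_ker, map_sub, e, sub_self]
    have := (hD.existsUnique_vadd_mem z).unique (y₁ := ⟨w - z, hk⟩) (y₂ := 0)
      (by change w - z + z ∈ D; simpa using hw)
      (by change (0 : CotEuclidean d) + z ∈ D; simpa using hz)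
    have h2 : w - z = 0 := congrArg Subtype.val this
    exact (sub_eq_zero.1 h2).symm
  have hGD : ∀ z ∈ D, ∀ w ∈ D, π (G 1 z) = π (G 1 w) → z = w := by
    intro z hz w hw e
    rw [hGπ, hGπ] at e
    exact hDinj z hz w hw (hIl.injective e)
  have hinj : InjOn (G 1) D := fun z hz w hw e => hGD z hz w hw (congrArg π e)
  have hmeas : MeasurableSet (G 1 '' D) :=
    hD.measurableSet.image_of_continuousOn_injOn hG1.continuous.continuousOn hinj
  have hfd : IsAddFundamentalDomain π.ker D :=
    IsAddFundamentalDomain.mk' hD.measurableSet.nullMeasurableSet hD.existsUnique_vadd_mem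
  have hfd' : IsAddFundamentalDomain π.ker (G 1 '' D) := by
    refine IsAddFundamentalDomain.mk' hmeas.nullMeasurableSet fun z => ?_
    obtain ⟨w, hw⟩ := hD.isOpenQuotientMap.surjective (I (π z))
    obtain ⟨γ, hγ, -⟩ := hD.existsUnique_vadd_mem w
    have hγ' : ∀ γ : π.ker, ∀ w, π (γ +ᵥ w) = π w := fun γ w => by
      change π ((γ : CotEuclidean d) + w) = π w
      rw [map_add, AddMonoidHom.mem_ker.1 γ.2, zero_add]
    have e : π (G 1 (γ +ᵥ w)) = π z := by rw [hGπ, hγ', hw, hIr]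
    refine ⟨⟨G 1 (γ +ᵥ w) - z, ?_⟩, ⟨γ +ᵥ w, hγ, ?_⟩, ?_⟩
    · rw [AddMonoidHom.mem_ker, map_sub, e, sub_self]
    · exact (sub_add_cancel _ _).symm
    · rintro γ' ⟨w', hw', e'⟩
      have : w' = γ +ᵥ w := hGD _ hw' _ hγ (by rw [e', hγ', e])
      apply Subtype.ext
      rw [this] at e'
      change _ = G 1 (γ +ᵥ w) - z
      rw [e']
      exact (add_sub_cancel_right _ _).symm
  refine ⟨hφc.measurable, Measure.ext fun A hA => ?_⟩
  have hinv : ∀ γ : π.ker, (fun z => γ +ᵥ z) ⁻¹' (π ⁻¹' A) = π ⁻¹' A := fun γ => by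
    ext z
    change π ((γ : CotEuclidean d) + z) ∈ A ↔ π z ∈ A
    rw [map_add, AddMonoidHom.mem_ker.1 γ.2, zero_add]
  have hA' : MeasurableSet (π ⁻¹' A) := hπm hA
  set W := G 1 ⁻¹' (π ⁻¹' A) ∩ D
  have hW : MeasurableSet W := (hG1.continuous.measurable hA').inter hD.measurableSet
  have himg : G 1 '' W = π ⁻¹' A ∩ G 1 '' D := by rw [image_preimage_inter]
  have hvol := lintegral_abs_det_fderiv_eq_addHaar_image volume hW
    (fun z _ => ((hG1.differentiable (by simp) z).hasFDerivAt).hasFDerivWithinAt)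
    (hinj.mono inter_subset_right)
  simp only [hdet, ENNReal.ofReal_one, lintegral_const, one_mul, Measure.restrict_apply_univ,
    himg] at hvol
  rw [Measure.map_apply hφc.measurable hA]
  calc volume (φ 1 ⁻¹' A) = volume W := by
        rw [← hD.measurePreserving.measure_preimage (hφc.measurable hA).nullMeasurableSet,
          Measure.restrict_apply (hπm (hφc.measurable hA))]
        congr 2
        ext z; simp [hGπ]
    _ = volume (π ⁻¹' A ∩ D) := by rw [hvol, hfd'.measure_set_eq hfd hA' hinv]
    _ = volume A := by
        rw [← Measure.restrict_apply hA',
          hD.measurePreserving.measure_preimage hA.nullMeasurableSet]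

/-! ### Equimeasurable functions and limits of orbits -/

section Equimeasurable

variable {X : Type} [MeasureSpace X]

/-- `f` and `g` give the same volume to the preimages of all bounded open intervals. -/
def Equimeasurable (f g : X → ℝ) : Prop :=
  ∀ μ ν : ℝ, μ < ν → volume {x | μ < f x ∧ f x < ν} = volume {x | μ < g x ∧ g x < ν}

theorem measure_setOf_between_congr {f g : X → ℝ} (h : f =ᵐ[volume] g) (μ ν : ℝ) :
    volume {x | μ < f x ∧ f x < ν} = volume {x | μ < g x ∧ g x < ν} := by
  refine measure_congr ?_
  filter_upwards [h] with x hx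
  exact propext (by change (_ ∧ _) ↔ (_ ∧ _); rw [hx])

/-- Continuity of the measure from below, for an open interval exhausted by smaller ones. -/
theorem measure_between_le_of_forall_shrink {g : X → ℝ} {μ ν : ℝ} {c : ℝ≥0∞}
    (h : ∀ η : ℝ, 0 < η → volume {x | μ + η < g x ∧ g x < ν - η} ≤ c) :
    volume {x | μ < g x ∧ g x < ν} ≤ c := by
  have hU : {x | μ < g x ∧ g x < ν}
      = ⋃ n : ℕ, {x | μ + 1 / ((n : ℝ) + 1) < g x ∧ g x < ν - 1 / ((n : ℝ) + 1)} := by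
    ext x
    simp only [mem_ofPred_eq, mem_iUnion]
    constructor
    · rintro ⟨h1, h2⟩
      obtain ⟨n, hn⟩ := exists_nat_one_div_lt (lt_min (sub_pos.2 h1) (sub_pos.2 h2))
      obtain ⟨h3, h4⟩ := lt_min_iff.1 hn
      exact ⟨n, by linarith, by linarith⟩
    · rintro ⟨n, h1, h2⟩
      have : (0 : ℝ) < 1 / ((n : ℝ) + 1) := Nat.one_div_pos_of_nat
      exact ⟨by linarith, by linarith⟩
  have hmono : Monotone fun n : ℕ =>
      {x | μ + 1 / ((n : ℝ) + 1) < g x ∧ g x < ν - 1 / ((n : ℝ) + 1)} := by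
    intro n m hnm x hx
    have : 1 / ((m : ℝ) + 1) ≤ 1 / ((n : ℝ) + 1) := Nat.one_div_le_one_div hnm
    exact ⟨by linarith [hx.1], by linarith [hx.2]⟩
  rw [hU, hmono.measure_iUnion]
  exact iSup_le fun n => h _ Nat.one_div_pos_of_nat

theorem measure_shrink_le_add (f g : X → ℝ) (μ ν : ℝ) {η : ℝ} (hη : 0 < η) :
    volume {x | μ + η < g x ∧ g x < ν - η}
      ≤ volume {x | μ < f x ∧ f x < ν} + volume {x | ENNReal.ofReal η ≤ edist (f x) (g x)} := by
  refine le_trans (measure_mono ?_) (measure_union_le _ _)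
  rintro x ⟨h1, h2⟩
  rcases le_or_gt (ENNReal.ofReal η) (edist (f x) (g x)) with h3 | h3
  · exact Or.inr h3
  · left
    rw [edist_dist, ENNReal.ofReal_lt_ofReal_iff hη, Real.dist_eq, abs_lt] at h3
    exact ⟨by linarith, by linarith⟩

/-- Equimeasurability passes to limits in measure. -/
theorem Equimeasurable.of_tendstoInMeasure {f : ℕ → X → ℝ} {g g₀ : X → ℝ}
    (h : TendstoInMeasure volume f atTop g) (hf : ∀ n, Equimeasurable (f n) g₀) :
    Equimeasurable g g₀ := by
  intro μ ν hμν
  have hlim : ∀ (c : ℝ≥0∞) (η : ℝ), 0 < η →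
      Tendsto (fun n => c + volume {x | ENNReal.ofReal η ≤ edist (f n x) (g x)}) atTop (𝓝 c) := by
    intro c η hη
    simpa using (h (ENNReal.ofReal η) (by simpa using hη)).const_add c
  refine le_antisymm (measure_between_le_of_forall_shrink fun η hη => ?_)
    (measure_between_le_of_forall_shrink fun η hη => ?_)
  · refine ge_of_tendsto' (hlim _ η hη) fun n => ?_
    rw [← hf n μ ν hμν]
    exact measure_shrink_le_add _ _ _ _ hη
  · refine ge_of_tendsto' (hlim _ η hη) fun n => ?_
    rcases lt_or_ge (μ + η) (ν - η) with hlt | hle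
    · rw [← hf n _ _ hlt]
      simpa only [edist_comm] using measure_shrink_le_add g (f n) μ ν hη
    · have : {x | μ + η < g₀ x ∧ g₀ x < ν - η} = ∅ :=
        eq_empty_of_forall_notMem fun x hx => by linarith [hx.1, hx.2]
      rw [this, measure_empty]
      exact zero_le

end Equimeasurable

section OrbitLimit

variable {d : ℕ} {X : Type} [MeasureSpace X] {r : ℝ≥0∞}

/-- Composition in `Lʳ` with a sequence of measure preserving maps converges as soon as the maps
are almost everywhere eventually equal to the limit map. -/
theorem tendsto_compMeasurePreserving_of_ae_eventually_eq [Fact (1 ≤ r)] (hr : r ≠ ⊤)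
    {Φ : ℕ → X → X} {F : X → X} (hΦ : ∀ n, MeasurePreserving (Φ n) volume volume)
    (hF : MeasurePreserving F volume volume)
    (h : ∀ᵐ x, ∀ᶠ n in atTop, Φ n x = F x) (ρ : Lp ℝ r (volume : Measure X)) :
    Tendsto (fun n => Lp.compMeasurePreserving (Φ n) (hΦ n) ρ) atTop
      (𝓝 (Lp.compMeasurePreserving F hF ρ)) := by
  refine Lp.induction hr (fun ρ => Tendsto (fun n => Lp.compMeasurePreserving (Φ n) (hΦ n) ρ) atTop
      (𝓝 (Lp.compMeasurePreserving F hF ρ))) ?_ ?_ ?_ ρ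
  · intro c s hs hμs
    simp only [Lp.simpleFunc.coe_indicatorConst, Lp.indicatorConstLp_compMeasurePreserving]
    refine tendsto_indicatorConstLp_set hr ?_
    -- both preimages of `s` have the volume of `s`, so it suffices to control one difference
    have hsymm : ∀ n, volume ((Φ n ⁻¹' s) ∆ (F ⁻¹' s))
        = volume (F ⁻¹' s \ Φ n ⁻¹' s) + volume (F ⁻¹' s \ Φ n ⁻¹' s) := by
      intro n
      have m1 := (hΦ n).measurable hs
      have m2 := hF.measurable hs
      have e1 := (hΦ n).measure_preimage hs.nullMeasurableSet
      have e2 := hF.measure_preimage hs.nullMeasurableSet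
      rw [measure_symmDiff_eq m1.nullMeasurableSet m2.nullMeasurableSet]
      congr 1
      have a1 := measure_sdiff_add_inter (μ := volume) (Φ n ⁻¹' s) m2
      have a2 := measure_sdiff_add_inter (μ := volume) (F ⁻¹' s) m1
      rw [inter_comm] at a2
      have hfin : volume (Φ n ⁻¹' s ∩ F ⁻¹' s) ≠ ⊤ :=
        ((measure_mono inter_subset_left).trans_lt (e1 ▸ hμs)).ne
      exact (ENNReal.add_left_inj hfin).1 (by rw [a1, a2, e1, e2])
    have hlim : Tendsto (fun n => volume (F ⁻¹' s \ Φ n ⁻¹' s)) atTop (𝓝 (volume (∅ : Set X))) := by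
      refine tendsto_measure_of_ae_tendsto_indicator atTop MeasurableSet.empty
        (fun n => (hF.measurable hs).diff ((hΦ n).measurable hs)) (hF.measurable hs)
        (by rw [hF.measure_preimage hs.nullMeasurableSet]; exact hμs.ne)
        (Eventually.of_forall fun n => sdiff_subset) ?_
      filter_upwards [h] with x hx
      filter_upwards [hx] with n hn
      simp [hn]
    rw [measure_empty] at hlim
    simp only [hsymm]
    simpa using hlim.add hlim
  · intro f g hf hg _ h1 h2
    simpa only [map_add] using h1.add h2
  · refine Equicontinuous.isClosed_setOfPred_tendsto ?_
      (Lp.isometry_compMeasurePreserving hF).continuous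
    refine Metric.equicontinuous_of_continuity_modulus id tendsto_id _ fun f g n => ?_
    exact ((Lp.isometry_compMeasurePreserving (hΦ n)).dist_eq f g).le

/-- `F` preserves the volume and maps every orbit of Hamiltonian diffeomorphisms in `Lʳ` into its
closure. -/
def IsOrbitLimit (π : CotEuclidean d → X) (r : ℝ≥0∞) [Fact (1 ≤ r)] (F : X → X) : Prop :=
  ∃ hF : MeasurePreserving F volume volume, ∀ ρ : Lp ℝ r (volume : Measure X),
    Lp.compMeasurePreserving F hF ρ ∈ closure (orbit π ρ)

variable {π : CotEuclidean d → X}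

theorem compMeasurePreserving_mem_orbit {Φ : X → X} (hΦ : Φ ∈ DHam π)
    (hΦ' : MeasurePreserving Φ volume volume) (ρ : Lp ℝ r (volume : Measure X)) :
    Lp.compMeasurePreserving Φ hΦ' ρ ∈ orbit π ρ :=
  ⟨Φ, hΦ, Lp.coeFn_compMeasurePreserving ρ hΦ'⟩

theorem exists_of_mem_orbit (hmp : ∀ Φ ∈ DHam π, MeasurePreserving Φ volume volume)
    {ρ σ : Lp ℝ r (volume : Measure X)} (h : σ ∈ orbit π ρ) :
    ∃ (Φ : X → X) (hΦ : MeasurePreserving Φ volume volume), Φ ∈ DHam π ∧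
      Lp.compMeasurePreserving Φ hΦ ρ = σ := by
  obtain ⟨Φ, hΦ, e⟩ := h
  exact ⟨Φ, hmp Φ hΦ, hΦ, Lp.ext ((Lp.coeFn_compMeasurePreserving ρ (hmp Φ hΦ)).trans e.symm)⟩

variable [Fact (1 ≤ r)]

theorem IsOrbitLimit.of_ae_eventually_eq (hr : r ≠ ⊤)
    (hmp : ∀ Φ ∈ DHam π, MeasurePreserving Φ volume volume) {Φ : ℕ → X → X} {F : X → X}
    (hΦ : ∀ n, Φ n ∈ DHam π) (hF : MeasurePreserving F volume volume)
    (h : ∀ᵐ x, ∀ᶠ n in atTop, Φ n x = F x) : IsOrbitLimit π r F :=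
  ⟨hF, fun ρ => mem_closure_of_tendsto
    (tendsto_compMeasurePreserving_of_ae_eventually_eq hr (fun n => hmp _ (hΦ n)) hF h ρ)
    (Eventually.of_forall fun n => compMeasurePreserving_mem_orbit (hΦ n) _ ρ)⟩

theorem IsOrbitLimit.comp (hmp : ∀ Φ ∈ DHam π, MeasurePreserving Φ volume volume)
    (hcomp : ∀ Φ ∈ DHam π, ∀ Ψ ∈ DHam π, Φ ∘ Ψ ∈ DHam π) {F F' : X → X}
    (hF : IsOrbitLimit π r F) (hF' : IsOrbitLimit π r F') : IsOrbitLimit π r (F ∘ F') := by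
  obtain ⟨mF, hF⟩ := hF
  obtain ⟨mF', hF'⟩ := hF'
  refine ⟨mF.comp mF', fun ρ => ?_⟩
  rw [Lp.compMeasurePreserving_comp_apply ρ mF mF']
  refine closure_minimal ?_ isClosed_closure (hF' (Lp.compMeasurePreserving F mF ρ))
  intro σ hσ
  obtain ⟨Ψ, mΨ, hΨ, rfl⟩ := exists_of_mem_orbit hmp hσ
  refine map_mem_closure (Lp.isometry_compMeasurePreserving mΨ).continuous (hF ρ) ?_
  intro τ hτ
  obtain ⟨Φ, mΦ, hΦ, rfl⟩ := exists_of_mem_orbit hmp hτ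
  rw [← Lp.compMeasurePreserving_comp_apply]
  exact compMeasurePreserving_mem_orbit (hcomp Φ hΦ Ψ hΨ) _ ρ

/-- Every function in the closure of an orbit is equimeasurable with the base point. -/
theorem equimeasurable_of_mem_closure_orbit
    (hmp : ∀ Φ ∈ DHam π, MeasurePreserving Φ volume volume)
    {ρ σ : Lp ℝ r (volume : Measure X)} (h : σ ∈ closure (orbit π ρ)) : Equimeasurable σ ρ := by
  obtain ⟨u, hu, hlim⟩ := mem_closure_iff_seq_limit.1 h
  refine Equimeasurable.of_tendstoInMeasure (tendstoInMeasure_of_tendsto_Lp hlim) fun n μ ν _ => ?_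
  obtain ⟨Φ, hΦ, e⟩ := hu n
  rw [measure_setOf_between_congr e]
  refine (hmp Φ hΦ).measure_preimage (s := {x | μ < ρ x ∧ ρ x < ν}) ?_
  have := (Lp.aestronglyMeasurable ρ).aemeasurable
  exact this.nullMeasurableSet_preimage (measurableSet_Ioo (a := μ) (b := ν))

end OrbitLimit

/-! ### Row and column translations of a grid -/

section Shifts

section Basic

variable {M N : Type}

/-- The permutation of the grid `M × N` that translates the row `n` by `a`. -/
def rowShift [AddCommGroup M] [DecidableEq N] (n : N) (a : M) (x : M × N) : M × N :=
  if x.2 = n then (x.1 + a, x.2) else x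

/-- The permutation of the grid `M × N` that translates the column `m` by `b`. -/
def columnShift [AddCommGroup N] [DecidableEq M] (m : M) (b : N) (x : M × N) : M × N :=
  if x.1 = m then (x.1, x.2 + b) else x

theorem rowShift_mk_self [AddCommGroup M] [DecidableEq N] (n : N) (a p : M) :
    rowShift n a (p, n) = (p + a, n) := by simp [rowShift]

theorem rowShift_mk_of_ne [AddCommGroup M] [DecidableEq N] {n q : N} (h : q ≠ n) (a p : M) :
    rowShift n a (p, q) = (p, q) := by simp [rowShift, h]

theorem columnShift_mk_self [AddCommGroup N] [DecidableEq M] (m : M) (b q : N) :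
    columnShift m b (m, q) = (m, q + b) := by simp [columnShift]

theorem columnShift_mk_of_ne [AddCommGroup N] [DecidableEq M] {m p : M} (h : p ≠ m) (b q : N) :
    columnShift m b (p, q) = (p, q) := by simp [columnShift, h]

theorem rowShift_neg_rowShift [AddCommGroup M] [DecidableEq N] (n : N) (a : M) (x : M × N) :
    rowShift n (-a) (rowShift n a x) = x := by
  obtain ⟨p, q⟩ := x
  by_cases h : q = n <;> simp [rowShift, h]

theorem columnShift_neg_columnShift [AddCommGroup N] [DecidableEq M] (m : M) (b : N)
    (x : M × N) : columnShift m (-b) (columnShift m b x) = x := by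
  obtain ⟨p, q⟩ := x
  by_cases h : p = m <;> simp [columnShift, h]

end Basic

variable {M N : Type} [AddCommGroup M] [AddCommGroup N] [DecidableEq M] [DecidableEq N]

/-- A row and a column meet in one point, so that the commutator of their translations is a
3-cycle. -/
theorem commutator_rowShift_columnShift (m : M) (n : N) {a : M} {b : N} (ha : a ≠ 0) (hb : b ≠ 0) :
    rowShift n (-a) ∘ columnShift m (-b) ∘ rowShift n a ∘ columnShift m b
      = ⇑(Equiv.swap (m, n) (m - a, n) * Equiv.swap (m - a, n) (m, n - b)) := by
  have h1 : n + b ≠ n := by simpa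
  have h2 : m + a ≠ m := by simpa
  have h3 : m - a ≠ m := by simpa
  have h4 : n - b ≠ n := by simpa
  funext ⟨p, q⟩
  simp only [Function.comp_apply, Equiv.Perm.mul_apply]
  rcases eq_or_ne p m with rfl | hp
  · rw [columnShift_mk_self]
    rcases eq_or_ne q (n - b) with rfl | hq
    · simp [rowShift_mk_self, columnShift_mk_of_ne h2]
    · have : q + b ≠ n := fun h => hq (eq_sub_of_add_eq h)
      rw [rowShift_mk_of_ne this, columnShift_mk_self, add_neg_cancel_right,
        Equiv.swap_apply_of_ne_of_ne (a := (p - a, n)) (by simp [h3.symm]) (by simp [hq])]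
      rcases eq_or_ne q n with rfl | hq'
      · simp [rowShift_mk_self, sub_eq_add_neg]
      · rw [rowShift_mk_of_ne hq', Equiv.swap_apply_of_ne_of_ne (by simp [hq']) (by simp [hq'])]
  · rw [columnShift_mk_of_ne hp]
    rcases eq_or_ne q n with rfl | hq
    · rw [rowShift_mk_self]
      rcases eq_or_ne p (m - a) with rfl | hp'
      · rw [sub_add_cancel, columnShift_mk_self, ← sub_eq_add_neg, rowShift_mk_of_ne h4,
          Equiv.swap_apply_left, Equiv.swap_apply_of_ne_of_ne] <;> simp [h3.symm, hb]
      · have : p + a ≠ m := fun h => hp' (eq_sub_of_add_eq h)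
        rw [columnShift_mk_of_ne this, rowShift_mk_self, add_neg_cancel_right,
          Equiv.swap_apply_of_ne_of_ne (a := (m - a, q)) (by simp [hp']) (by simp [hp]),
          Equiv.swap_apply_of_ne_of_ne (by simp [hp]) (by simp [hp'])]
    · rw [rowShift_mk_of_ne hq, columnShift_mk_of_ne hp, rowShift_mk_of_ne hq,
        Equiv.swap_apply_of_ne_of_ne (a := (m - a, n)) (by simp [hq]) (by simp [hp]),
        Equiv.swap_apply_of_ne_of_ne (by simp [hp]) (by simp [hq])]

theorem commutator_columnShift_rowShift (m : M) (n : N) {a : M} {b : N} (ha : a ≠ 0)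
    (hb : b ≠ 0) :
    columnShift m (-b) ∘ rowShift n (-a) ∘ columnShift m b ∘ rowShift n a
      = ⇑(Equiv.swap (m - a, n) (m, n - b) * Equiv.swap (m, n) (m - a, n)) := by
  funext x
  have h := congrFun (commutator_rowShift_columnShift m n ha hb)
    ((Equiv.swap (m - a, n) (m, n - b) * Equiv.swap (m, n) (m - a, n)) x)
  simp only [Equiv.Perm.mul_apply, Equiv.swap_apply_self, Function.comp_apply] at h ⊢
  conv_lhs => rw [← h]
  have e1 := fun x : M × N => rowShift_neg_rowShift n (-a) x
  have e2 := fun x : M × N => columnShift_neg_columnShift m (-b) x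
  simp only [neg_neg] at e1 e2
  simp only [e1, e2, rowShift_neg_rowShift, columnShift_neg_columnShift]

/-- On every finite set, `f` agrees with a member of `R`. -/
def LocallyIn {I : Type} (R : Set (I → I)) (f : I → I) : Prop :=
  ∀ E : Finset I, ∃ g ∈ R, ∀ x ∈ E, g x = f x

theorem LocallyIn.of_mem {I : Type} {R : Set (I → I)} {f : I → I} (h : f ∈ R) : LocallyIn R f :=
  fun _ => ⟨f, h, fun _ _ => rfl⟩

theorem LocallyIn.comp {I : Type} {R : Set (I → I)} (hR : ∀ f ∈ R, ∀ g ∈ R, f ∘ g ∈ R)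
    {f g : I → I} (hf : LocallyIn R f) (hg : LocallyIn R g) : LocallyIn R (f ∘ g) := by
  classical
  intro E
  obtain ⟨g', hg', e⟩ := hg E
  obtain ⟨f', hf', e'⟩ := hf (E.image g)
  refine ⟨f' ∘ g', hR f' hf' g' hg', fun x hx => ?_⟩
  rw [Function.comp_apply, Function.comp_apply, e x hx, e' _ (Finset.mem_image_of_mem g hx)]

variable {R : Set (M × N → M × N)} (hR : ∀ f ∈ R, ∀ g ∈ R, f ∘ g ∈ R)
  (hrow : ∀ n a, rowShift n a ∈ R) (hcol : ∀ m b, columnShift m b ∈ R)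

include hR hrow hcol

/-- The cyclic permutation of three corners of a rectangle belongs to `R`. -/
theorem mem_of_corner {m m' : M} {n n' : N} (hm : m' ≠ m) (hn : n' ≠ n) :
    ⇑(Equiv.swap (m, n) (m', n) * Equiv.swap (m', n) (m, n')) ∈ R := by
  have h := commutator_rowShift_columnShift m n (sub_ne_zero.2 hm.symm) (sub_ne_zero.2 hn.symm)
  rw [sub_sub_cancel, sub_sub_cancel] at h
  rw [← h]
  exact hR _ (hrow _ _) _ (hR _ (hcol _ _) _ (hR _ (hrow _ _) _ (hcol _ _)))

/-- The inverse of the 3-cycle of `mem_of_corner`. -/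
theorem mem_of_corner' {m m' : M} {n n' : N} (hm : m' ≠ m) (hn : n' ≠ n) :
    ⇑(Equiv.swap (m', n) (m, n') * Equiv.swap (m, n) (m', n)) ∈ R := by
  have h := commutator_columnShift_rowShift m n (sub_ne_zero.2 hm.symm) (sub_ne_zero.2 hn.symm)
  rw [sub_sub_cancel, sub_sub_cancel] at h
  rw [← h]
  exact hR _ (hcol _ _) _ (hR _ (hrow _ _) _ (hR _ (hcol _ _) _ (hrow _ _)))

/-- Two 3-cycles at opposite corners of a rectangle compose to the exchange of the ends of two
opposite sides, and one of the sides can be placed outside a given finite set: this gives odd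
permutations of the other cells. -/
theorem locallyIn_swap_row [Infinite N] (m m' : M) (n : N) :
    LocallyIn R (Equiv.swap (m, n) (m', n)) := by
  rcases eq_or_ne m' m with rfl | hm
  · intro E
    refine ⟨_, hrow n 0, fun x _ => ?_⟩
    simp [rowShift]
  intro E
  obtain ⟨n', hn'⟩ := Infinite.exists_notMem_finset (insert n (E.image Prod.snd))
  rw [Finset.mem_insert, not_or] at hn'
  refine ⟨_, hR _ (mem_of_corner hR hrow hcol hm hn'.1) _
    (mem_of_corner' hR hrow hcol (m := m') (m' := m) (n := n') (n' := n) hm.symm (Ne.symm hn'.1)),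
    fun x hx => ?_⟩
  have h1 : x ≠ (m', n') := fun h => hn'.2 (Finset.mem_image.2 ⟨x, hx, by rw [h]⟩)
  have h2 : x ≠ (m, n') := fun h => hn'.2 (Finset.mem_image.2 ⟨x, hx, by rw [h]⟩)
  simp only [Function.comp_apply, Equiv.Perm.mul_apply]
  rw [Equiv.swap_apply_of_ne_of_ne h1 h2, Equiv.swap_comm (m, n') (m', n), Equiv.swap_apply_self]

/-- The exchange of two cells in a column is conjugate, by a 3-cycle, to an exchange in a row. -/
theorem locallyIn_swap_column [Infinite N] [Nontrivial M] (m : M) (n n' : N) :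
    LocallyIn R (Equiv.swap (m, n) (m, n')) := by
  rcases eq_or_ne n' n with rfl | hn
  · simpa using locallyIn_swap_row hR hrow hcol m m n'
  obtain ⟨m', hm⟩ := exists_ne m
  set c := Equiv.swap (m', n) (m, n') * Equiv.swap (m, n) (m', n) with hc
  have hc1 : c (m, n) = (m, n') := by
    simp [hc, Equiv.Perm.mul_apply]
  have hc2 : c (m', n) = (m, n) := by
    rw [hc, Equiv.Perm.mul_apply, Equiv.swap_apply_right, Equiv.swap_apply_of_ne_of_ne]
    · simp [hm.symm]
    · simp [hn.symm]
  have hinv : c⁻¹ = Equiv.swap (m, n) (m', n) * Equiv.swap (m', n) (m, n') := by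
    rw [hc, mul_inv_rev, Equiv.swap_inv, Equiv.swap_inv]
  have key : Equiv.swap (m, n) (m, n') = c * Equiv.swap (m, n) (m', n) * c⁻¹ := by
    rw [← Equiv.swap_apply_apply, hc1, hc2, Equiv.swap_comm]
  rw [key, Equiv.Perm.coe_mul, Equiv.Perm.coe_mul]
  refine LocallyIn.comp hR (LocallyIn.comp hR (.of_mem ?_)
    (locallyIn_swap_row hR hrow hcol m m' n)) (.of_mem ?_)
  · exact mem_of_corner' hR hrow hcol hm hn
  · rw [hinv]; exact mem_of_corner hR hrow hcol hm hn

theorem locallyIn_swap [Infinite N] [Nontrivial M] (x y : M × N) :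
    LocallyIn R (Equiv.swap x y) := by
  obtain ⟨m, n⟩ := x
  obtain ⟨m', n'⟩ := y
  rcases eq_or_ne m m' with rfl | hm
  · exact locallyIn_swap_column hR hrow hcol m n n'
  rcases eq_or_ne n n' with rfl | hn
  · exact locallyIn_swap_row hR hrow hcol m m' n
  have key : Equiv.swap (m, n) (m', n') = Equiv.swap (m, n) (m', n)
      * Equiv.swap (m', n) (m', n') * (Equiv.swap (m, n) (m', n))⁻¹ := by
    rw [← Equiv.swap_apply_apply, Equiv.swap_apply_right, Equiv.swap_apply_of_ne_of_ne]
    · simp [hm.symm]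
    · simp [hn.symm]
  rw [key, Equiv.Perm.coe_mul, Equiv.Perm.coe_mul, Equiv.swap_inv]
  have h := locallyIn_swap_row hR hrow hcol m m' n
  exact (h.comp hR (locallyIn_swap_column hR hrow hcol m' n n')).comp hR h

/-- Row and column translations generate a monoid that realizes all injections of finite sets. -/
theorem exists_mem_eq_of_injOn [Infinite N] [Nontrivial M] (s : Finset (M × N))
    {f : M × N → M × N} (hf : InjOn f s) : ∃ g ∈ R, ∀ x ∈ s, g x = f x := by
  have key : ∀ s : Finset (M × N), InjOn f s →
      ∃ g : Equiv.Perm (M × N), LocallyIn R g ∧ ∀ x ∈ s, g x = f x := by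
    intro s
    induction s using Finset.induction_on with
    | empty =>
      intro _
      exact ⟨1, by simpa using locallyIn_swap_row hR hrow hcol 0 0 0, by simp⟩
    | insert a s ha ih =>
      intro hf
      obtain ⟨g, hg, e⟩ := ih (hf.mono (by simp))
      refine ⟨Equiv.swap (g a) (f a) * g, (locallyIn_swap hR hrow hcol _ _).comp hR hg,
        fun x hx => ?_⟩
      rw [Equiv.Perm.mul_apply]
      rcases Finset.mem_insert.1 hx with rfl | hx'
      · rw [Equiv.swap_apply_left]
      · have hxa : x ≠ a := fun h => ha (h ▸ hx')
        rw [Equiv.swap_apply_of_ne_of_ne (g.injective.ne hxa), e x hx']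
        rw [e x hx']
        exact fun h => hxa (hf (by simp [hx']) (by simp) h)
  obtain ⟨g, hg, e⟩ := key s hf
  obtain ⟨g', hg', e'⟩ := hg s
  exact ⟨g', hg', fun x hx => (e' x hx).trans (e x hx)⟩

end Shifts

/-! ### Hamiltonian shears and translations of cells -/

section Shears

variable {Y : Type} [NormedAddCommGroup Y] (κ : ℝ →+ Y)

/-- The covering `T*ℝᵈ → Yᵈ × ℝᵈ` induced by a one-dimensional covering `κ : ℝ → Y`. For `Y = ℝ`
this is the identity, for the circle it is `torusCover`. -/
def phaseCover (d : ℕ) : CotEuclidean d →+ (Fin d → Y) × (Fin d → ℝ) where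
  toFun z := (fun i => κ (z.1 i), z.2)
  map_zero' := by ext <;> simp
  map_add' z w := by ext <;> simp

variable {κ} {d : ℕ}

theorem phaseCover_apply (z : CotEuclidean d) :
    phaseCover κ d z = (fun i => κ (z.1 i), z.2) := rfl

/-- The gradient of a function of `d` real variables. -/
def coordGradient (f : (Fin d → ℝ) → ℝ) (x : Fin d → ℝ) : Fin d → ℝ :=
  fun i => fderiv ℝ f x (Pi.single i 1)

theorem contDiff_coordGradient {f : (Fin d → ℝ) → ℝ} (hf : ContDiff ℝ ∞ f) :
    ContDiff ℝ ∞ (coordGradient f) :=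
  contDiff_pi.2 fun _ => (hf.fderiv_right (by simp)).clm_apply contDiff_const

/-- The time-one map of a Hamiltonian depending on the momenta only. -/
theorem qShear_mem_DHam {f : (Fin d → ℝ) → ℝ} (hf : ContDiff ℝ ∞ f) :
    (fun x : (Fin d → Y) × (Fin d → ℝ) => (x.1 + fun i => κ (coordGradient f x.2 i), x.2))
      ∈ DHam (phaseCover κ d) := by
  have hg := contDiff_coordGradient hf
  set φ : ℝ → (Fin d → Y) × (Fin d → ℝ) → (Fin d → Y) × (Fin d → ℝ) :=
    fun t x => (x.1 + fun i => κ (t * coordGradient f x.2 i), x.2) with hφ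
  set G : ℝ → CotEuclidean d → CotEuclidean d :=
    fun t z => (z.1 + t • coordGradient f z.2, z.2) with hG
  have hGφ : ∀ t z, phaseCover κ d (G t z) = φ t (phaseCover κ d z) := by
    intro t z
    ext i
    · simp [phaseCover_apply, hG, hφ]
    · rfl
  have hGs : ContDiff ℝ ∞ fun y : ℝ × CotEuclidean d => G y.1 y.2 :=
    ((contDiff_fst.comp contDiff_snd).add
      (contDiff_fst.smul (hg.comp (contDiff_snd.comp contDiff_snd)))).prodMk
      (contDiff_snd.comp contDiff_snd)
  have hsm : ∀ t, IsSmoothMap (phaseCover κ d) (φ t) := fun t =>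
    ⟨G t, hGs.comp (contDiff_const.prodMk contDiff_id), hGφ t⟩
  have hinv : ∀ t x, φ (-t) (φ t x) = x := by
    intro t x
    ext i
    · simp [hφ]
    · rfl
  refine ⟨fun _ x => f x.2, φ, ⟨?_, fun t => ⟨hsm t, φ (-t), hsm _, hinv t, fun x => ?_⟩, ?_,
    G, hGs, hGφ, fun t z => ?_⟩, ?_⟩
  · exact (hf.comp (contDiff_snd.comp contDiff_snd) :
      ContDiff ℝ ∞ fun y : ℝ × CotEuclidean d => f y.2.2)
  · simpa using hinv (-t) x
  · funext x
    ext i <;> simp [hφ]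
  · have h1 : HasDerivAt (fun s => G s z) (coordGradient f z.2, 0) t := by
      have : HasDerivAt (fun s : ℝ => z.1 + s • coordGradient f z.2) (coordGradient f z.2) t := by
        simpa using ((hasDerivAt_id t).smul_const (coordGradient f z.2)).const_add z.1
      exact this.prodMk (hasDerivAt_const t z.2)
    have h2 : ∀ w : CotEuclidean d, HasFDerivAt (fun w : CotEuclidean d => f w.2)
        ((fderiv ℝ f w.2).comp (.snd ℝ (Fin d → ℝ) (Fin d → ℝ))) w := fun w =>
      (hf.differentiable (by simp) w.2).hasFDerivAt.comp w hasFDerivAt_snd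
    refine h1.congr_deriv ?_
    ext i
    · simp [hamiltonianVectorField, phaseCover_apply, (h2 _).fderiv, coordGradient, hG]
    · simp [hamiltonianVectorField, phaseCover_apply, (h2 _).fderiv]
  · funext x
    simp [hφ]

/-- The gradient of a function on `Yᵈ`, computed in the covering, does not depend on the lift. -/
theorem coordGradient_eq_of_lift_eq (g : (Fin d → Y) → ℝ) {q q' : Fin d → ℝ}
    (h : (fun i => κ (q i)) = fun i => κ (q' i)) :
    coordGradient (fun q => g fun i => κ (q i)) q =
      coordGradient (fun q => g fun i => κ (q i)) q' := by
  have e : (fun q : Fin d → ℝ => g fun i => κ (q i))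
      = fun w => g fun i => κ ((w + (q' - q)) i) := by
    funext w
    congr 1
    funext i
    simp [(congrFun h i).symm]
  have h : fderiv ℝ (fun q => g fun i => κ (q i)) q' =
      fderiv ℝ (fun q => g fun i => κ (q i)) q := by
    conv_rhs => rw [e]
    rw [fderiv_comp_add_right (f := fun w : Fin d → ℝ => g fun i => κ (w i)), add_sub_cancel]
  funext i
  simp only [coordGradient, h]

/-- The time-one map of a Hamiltonian depending on the positions only. -/
theorem exists_pShear_mem_DHam (hκ : Function.Surjective κ) {g : (Fin d → Y) → ℝ}
    (hg : ContDiff ℝ ∞ fun q : Fin d → ℝ => g fun i => κ (q i)) :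
    ∃ Φ ∈ DHam (phaseCover κ d), ∀ (q : Fin d → ℝ) (p : Fin d → ℝ),
      Φ (fun i => κ (q i), p)
        = (fun i => κ (q i), p - coordGradient (fun q => g fun i => κ (q i)) q) := by
  set γ : (Fin d → ℝ) → Fin d → ℝ := coordGradient (fun q => g fun i => κ (q i)) with hγ
  have hγs : ContDiff ℝ ∞ γ := contDiff_coordGradient hg
  choose s hs using fun y : Fin d → Y => (hκ.comp_left (α := Fin d)) y
  have hγs' : ∀ q : Fin d → ℝ, γ (s fun i => κ (q i)) = γ q := fun q =>
    coordGradient_eq_of_lift_eq g (hs fun i => κ (q i))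
  set φ : ℝ → (Fin d → Y) × (Fin d → ℝ) → (Fin d → Y) × (Fin d → ℝ) :=
    fun t x => (x.1, x.2 - t • γ (s x.1)) with hφ
  set G : ℝ → CotEuclidean d → CotEuclidean d := fun t z => (z.1, z.2 - t • γ z.1) with hG
  have hGφ : ∀ t z, phaseCover κ d (G t z) = φ t (phaseCover κ d z) := by
    intro t z
    simp only [phaseCover_apply, hG, hφ, hγs']
  have hGs : ContDiff ℝ ∞ fun y : ℝ × CotEuclidean d => G y.1 y.2 :=
    (contDiff_fst.comp contDiff_snd).prodMk ((contDiff_snd.comp contDiff_snd).sub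
      (contDiff_fst.smul (hγs.comp (contDiff_fst.comp contDiff_snd))))
  have hsm : ∀ t, IsSmoothMap (phaseCover κ d) (φ t) := fun t =>
    ⟨G t, hGs.comp (contDiff_const.prodMk contDiff_id), hGφ t⟩
  have hinv : ∀ t x, φ (-t) (φ t x) = x := by
    intro t x
    simp [hφ]
  refine ⟨φ 1, ⟨fun _ x => g x.1, φ, ⟨?_, fun t => ⟨hsm t, φ (-t), hsm _, hinv t, fun x => ?_⟩, ?_,
    G, hGs, hGφ, fun t z => ?_⟩, rfl⟩, fun q p => ?_⟩
  · exact hg.comp (contDiff_fst.comp contDiff_snd)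
  · simpa using hinv (-t) x
  · funext x
    simp [hφ]
  · have h1 : HasDerivAt (fun s => G s z) (0, -γ z.1) t := by
      have : HasDerivAt (fun s : ℝ => z.2 - s • γ z.1) (-γ z.1) t := by
        simpa using ((hasDerivAt_id t).smul_const (γ z.1)).const_sub z.2
      exact (hasDerivAt_const t z.1).prodMk this
    have h2 : ∀ w : CotEuclidean d, HasFDerivAt (fun w : CotEuclidean d => g fun i => κ (w.1 i))
        ((fderiv ℝ (fun q : Fin d → ℝ => g fun i => κ (q i)) w.1).comp
          (.fst ℝ (Fin d → ℝ) (Fin d → ℝ))) w := fun w =>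
      (hg.differentiable (by simp) w.1).hasFDerivAt.comp w hasFDerivAt_fst
    refine h1.congr_deriv ?_
    ext i
    · simp [hamiltonianVectorField, phaseCover_apply, (h2 _).fderiv]
    · simp [hamiltonianVectorField, phaseCover_apply, (h2 _).fderiv, hG, hγ, coordGradient]
  · simp [hφ, hγs']

end Shears

/-- `c : Y → A` divides `Y` into cells of diameter at most `δ` and of equal positive volume, which
are permuted by translations according to the group structure of `A`. Up to a null set, the cell
`a` is the set where a smooth function `e` is positive, and on it there is a smooth coordinate `h`
which extends to all of `Y`; smoothness is measured in the covering `κ : ℝ → Y`. -/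
structure IsGrid {A Y : Type} [AddCommGroup A] [NormedAddCommGroup Y] [MeasureSpace Y]
    (κ : ℝ →+ Y) (δ : ℝ) (c : Y → A) : Prop where
  measurableSet : ∀ a, MeasurableSet (c ⁻¹' {a})
  dist_le : ∀ y y', c y = c y' → dist y y' ≤ δ
  exists_shift : ∀ a, ∃ τ : ℝ, ∀ y, c (y + κ τ) = c y + a
  exists_height : ∀ a, ∃ e h : Y → ℝ, ContDiff ℝ ∞ (fun x => e (κ x)) ∧
    ContDiff ℝ ∞ (fun x => h (κ x)) ∧
    (∀ x, 0 < e (κ x) → c (κ x) = a ∧ deriv (fun x => h (κ x)) x = 1) ∧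
    (∀ x, e (κ x) < 0 → c (κ x) ≠ a) ∧ volume {y | e y = 0} = 0
  exists_volume : ∃ m : ℝ≥0∞, m ≠ 0 ∧ m ≠ ⊤ ∧ ∀ a, volume (c ⁻¹' {a}) = m

section CellTranslation

variable {A Y : Type} [AddCommGroup A] [NormedAddCommGroup Y] [MeasureSpace Y]
  {κ : ℝ →+ Y} {δ : ℝ} {c : Y → A} {d : ℕ}

/-- Smooth functions whose gradients converge, almost everywhere and in finitely many steps, to the
vector field that is equal to `v` on one cell of the product grid and vanishes elsewhere. -/
theorem IsGrid.exists_seq_gradient [SigmaFinite (volume : Measure Y)] [DecidableEq A]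
    (hc : IsGrid κ δ c) (m : Fin d → A) (v : Fin d → ℝ) :
    ∃ g : ℕ → (Fin d → Y) → ℝ, (∀ n, ContDiff ℝ ∞ fun q : Fin d → ℝ => g n fun i => κ (q i)) ∧
      ∀ᵐ y : Fin d → Y, ∀ q : Fin d → ℝ, (fun i => κ (q i)) = y → ∀ᶠ n in atTop,
        coordGradient (fun q => g n fun i => κ (q i)) q
          = if (fun i => c (y i)) = m then v else 0 := by
  choose e h he hh hpos hneg hnull using fun i => hc.exists_height (m i)
  refine ⟨fun n y => (∏ i, Real.smoothTransition (n * e i (y i))) * ∑ i, v i * h i (y i),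
    fun n => ?_, ?_⟩
  · refine ContDiff.mul ?_ ?_
    · exact contDiff_prod fun i _ => Real.smoothTransition.contDiff.comp
        (contDiff_const.mul ((he i).comp (contDiff_apply ℝ ℝ i)))
    · exact ContDiff.sum fun i _ => contDiff_const.mul ((hh i).comp (contDiff_apply ℝ ℝ i))
  · have hae : ∀ᵐ y : Fin d → Y, ∀ i, e i (y i) ≠ 0 := by
      rw [ae_all_iff]
      intro i
      have : ∀ᵐ y : Y, e i y ≠ 0 := by
        rw [ae_iff]; simpa using hnull i
      exact (Measure.quasiMeasurePreserving_eval (fun _ => (volume : Measure Y)) i).ae this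
    filter_upwards [hae] with y hy q hq
    subst hq
    by_cases hall : ∀ i, 0 < e i (κ (q i))
    · have hcm : (fun i => c (κ (q i))) = m := funext fun i => (hpos i (q i) (hall i)).1
      have hev : ∀ᶠ n : ℕ in atTop, ∀ i, 1 < (n : ℝ) * e i (κ (q i)) := by
        rw [eventually_all]
        intro i
        exact (tendsto_natCast_atTop_atTop.atTop_mul_const (hall i)).eventually_gt_atTop 1
      filter_upwards [hev] with n hn
      rw [if_pos hcm]
      have hloc : (fun q : Fin d → ℝ => (∏ i, Real.smoothTransition (n * e i (κ (q i))))
          * ∑ i, v i * h i (κ (q i))) =ᶠ[𝓝 q] fun q => ∑ i, v i * h i (κ (q i)) := by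
        have : ∀ᶠ w : Fin d → ℝ in 𝓝 q, ∀ i, 1 < (n : ℝ) * e i (κ (w i)) := by
          rw [eventually_all]
          intro i
          exact (continuous_const.mul ((he i).continuous.comp
            (continuous_apply i))).continuousAt.eventually_const_lt (hn i)
        filter_upwards [this] with w hw
        rw [Finset.prod_eq_one fun i _ => Real.smoothTransition.one_of_one_le (hw i).le, one_mul]
      have hfd : HasFDerivAt (fun q : Fin d → ℝ => ∑ i, v i * h i (κ (q i)))
          (∑ i, (v i) • (ContinuousLinearMap.toSpanSingleton ℝ (1 : ℝ)).comp
            (ContinuousLinearMap.proj i : (Fin d → ℝ) →L[ℝ] ℝ)) q := by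
        refine HasFDerivAt.fun_sum fun i _ => ?_
        have h1 : HasDerivAt (fun x => h i (κ x)) 1 (q i) := by
          rw [← (hpos i (q i) (hall i)).2]
          exact ((hh i).differentiable (by simp) (q i)).hasDerivAt
        have h2 : HasFDerivAt (fun q : Fin d → ℝ => h i (κ (q i))) _ q :=
          HasFDerivAt.comp (g := fun x => h i (κ x)) q h1.hasFDerivAt (hasFDerivAt_apply i q)
        exact h2.const_mul (v i)
      funext j
      rw [coordGradient, hloc.fderiv_eq, hfd.fderiv]
      simp [Pi.single_apply]
    · push Not at hall
      obtain ⟨i, hi⟩ := hall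
      have hi : e i (κ (q i)) < 0 := lt_of_le_of_ne hi (hy i)
      have hcm : (fun i => c (κ (q i))) ≠ m := fun h => hneg i (q i) hi (congrFun h i)
      refine Eventually.of_forall fun n => ?_
      rw [if_neg hcm]
      have hloc : (fun q : Fin d → ℝ => (∏ i, Real.smoothTransition (n * e i (κ (q i))))
          * ∑ i, v i * h i (κ (q i))) =ᶠ[𝓝 q] fun _ => 0 := by
        have : ∀ᶠ w : Fin d → ℝ in 𝓝 q, e i (κ (w i)) < 0 :=
          ((he i).continuous.comp (continuous_apply i)).continuousAt.eventually_lt_const hi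
        filter_upwards [this] with w hw
        rw [Finset.prod_eq_zero (Finset.mem_univ i), zero_mul]
        exact Real.smoothTransition.zero_of_nonpos
          (mul_nonpos_of_nonneg_of_nonpos n.cast_nonneg hw.le)
      funext j
      rw [coordGradient, hloc.fderiv_eq]
      simp

/-- A point `(q, p)` of phase space is sent to the pair of cells containing `q` and `p`. -/
def phaseCell {A B Y : Type} {d : ℕ} (c : Y → A) (c' : ℝ → B) (x : (Fin d → Y) × (Fin d → ℝ)) :
    (Fin d → A) × (Fin d → B) :=
  (fun i => c (x.1 i), fun i => c' (x.2 i))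

theorem IsGrid.measurable_comp [Countable A] (hc : IsGrid κ δ c) {β : Type} [MeasurableSpace β]
    (f : (Fin d → A) → β) : Measurable fun y : Fin d → Y => f fun i => c (y i) := by
  let _ : MeasurableSpace A := ⊤
  have h1 : Measurable c := measurable_to_countable' hc.measurableSet
  have h2 : Measurable fun (y : Fin d → Y) i => c (y i) :=
    measurable_pi_lambda _ fun i => h1.comp (measurable_pi_apply i)
  exact (measurable_of_countable f).comp h2

variable {B : Type} [AddCommGroup B] {c' : ℝ → B} [SigmaFinite (volume : Measure Y)] {r : ℝ≥0∞}
  [Fact (1 ≤ r)]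

/-- Translating the positions of a row of cells is a limit of Hamiltonian shears. -/
theorem exists_isOrbitLimit_rowShift [Countable B] [DecidableEq B] [BorelSpace Y]
    [SecondCountableTopology Y] [(volume : Measure Y).IsAddLeftInvariant] (hr : r ≠ ⊤)
    (hmp : ∀ Φ ∈ DHam (phaseCover κ d), MeasurePreserving Φ volume volume)
    (hc : IsGrid κ δ c) (hc' : IsGrid (AddMonoidHom.id ℝ) δ c') (n : Fin d → B) (a : Fin d → A) :
    ∃ F, IsOrbitLimit (phaseCover κ d) r F ∧
      ∀ x, phaseCell c c' (F x) = rowShift n a (phaseCell c c' x) := by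
  choose τ hτ using fun i => hc.exists_shift (a i)
  obtain ⟨g, hg, hlim⟩ := hc'.exists_seq_gradient n τ
  let w : (Fin d → ℝ) → Fin d → ℝ := fun p => if (fun i => c' (p i)) = n then τ else 0
  refine ⟨fun x => (x.1 + fun i => κ (w x.2 i), x.2),
    IsOrbitLimit.of_ae_eventually_eq hr hmp (fun k => qShear_mem_DHam (κ := κ) (hg k)) ?_ ?_, ?_⟩
  · have hw : Measurable fun p : Fin d → ℝ => (fun i => κ (w p i) : Fin d → Y) :=
      hc'.measurable_comp fun b => fun i => κ ((if b = n then τ else 0 : Fin d → ℝ) i)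
    have h1 : MeasurePreserving
        (fun x : (Fin d → ℝ) × (Fin d → Y) => (x.1, x.2 + fun i => κ (w x.1 i))) volume volume := by
      refine (MeasurePreserving.id volume).skew_product
        (g := fun p q => q + fun i => κ (w p i)) ?_ (Eventually.of_forall fun p => ?_)
      · exact measurable_snd.add (hw.comp measurable_fst)
      · exact (measurePreserving_add_right volume (fun i => κ (w p i))).map_eq
    exact (Measure.measurePreserving_swap.comp h1).comp Measure.measurePreserving_swap
  · have h2 := (Measure.quasiMeasurePreserving_snd (μ := (volume : Measure (Fin d → Y)))
      (ν := (volume : Measure (Fin d → ℝ)))).ae hlim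
    filter_upwards [h2] with x hx
    filter_upwards [hx x.2 rfl] with k hk
    have hk' : coordGradient (g k) x.2 = w x.2 := hk
    change (x.1 + fun i => κ (coordGradient (g k) x.2 i), x.2) = _
    rw [hk']
  · intro x
    by_cases h : (fun i => c' (x.2 i)) = n
    · simp only [rowShift, phaseCell, w, h, if_true]
      ext i
      · exact hτ i (x.1 i)
      · rfl
    · simp [rowShift, phaseCell, w, h]

/-- Translating the momenta of a column of cells is a limit of Hamiltonian shears. -/
theorem exists_isOrbitLimit_columnShift [Countable A] [DecidableEq A] (hr : r ≠ ⊤)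
    (hκ : Function.Surjective κ)
    (hmp : ∀ Φ ∈ DHam (phaseCover κ d), MeasurePreserving Φ volume volume)
    (hc : IsGrid κ δ c) (hc' : IsGrid (AddMonoidHom.id ℝ) δ c') (m : Fin d → A) (b : Fin d → B) :
    ∃ F, IsOrbitLimit (phaseCover κ d) r F ∧
      ∀ x, phaseCell c c' (F x) = columnShift m b (phaseCell c c' x) := by
  choose τ hτ using fun i => hc'.exists_shift (b i)
  obtain ⟨g, hg, hlim⟩ := hc.exists_seq_gradient m (-τ)
  let w : (Fin d → Y) → Fin d → ℝ := fun q => if (fun i => c (q i)) = m then τ else 0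
  choose Φ hΦ hΦe using fun k => exists_pShear_mem_DHam hκ (hg k)
  refine ⟨fun x => (x.1, x.2 + w x.1),
    IsOrbitLimit.of_ae_eventually_eq hr hmp hΦ ?_ ?_, ?_⟩
  · have hw : Measurable w := hc.measurable_comp fun a => (if a = m then τ else 0 : Fin d → ℝ)
    refine (MeasurePreserving.id volume).skew_product
      (g := fun q p => p + w q) ?_ (Eventually.of_forall fun q => ?_)
    · exact measurable_snd.add (hw.comp measurable_fst)
    · exact (measurePreserving_add_right volume (w q)).map_eq
  · have h2 := (Measure.quasiMeasurePreserving_fst (μ := (volume : Measure (Fin d → Y)))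
      (ν := (volume : Measure (Fin d → ℝ)))).ae hlim
    filter_upwards [h2] with x hx
    obtain ⟨q, hq⟩ := hκ.comp_left (α := Fin d) x.1
    have hq : (fun i => κ (q i)) = x.1 := hq
    filter_upwards [hx q hq] with k hk
    have hx' : x = (fun i => κ (q i), x.2) := by rw [hq]
    rw [hx', hΦe, hk]
    simp only [w, hq]
    split_ifs <;> simp
  · intro x
    by_cases h : (fun i => c (x.1 i)) = m
    · simp only [columnShift, phaseCell, w, h, if_true]
      ext i
      · rw [← h]
      · exact hτ i (x.2 i)
    · simp [columnShift, phaseCell, w, h]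

/-- Every injection of a finite set of cells is induced, on that set, by a limit of Hamiltonian
diffeomorphisms. -/
theorem exists_isOrbitLimit_of_injOn [Countable A] [Countable B] [BorelSpace Y]
    [SecondCountableTopology Y] [(volume : Measure Y).IsAddLeftInvariant] (hr : r ≠ ⊤)
    (hκ : Function.Surjective κ)
    (hmp : ∀ Φ ∈ DHam (phaseCover κ d), MeasurePreserving Φ volume volume)
    (hcomp : ∀ Φ ∈ DHam (phaseCover κ d), ∀ Ψ ∈ DHam (phaseCover κ d),
      Φ ∘ Ψ ∈ DHam (phaseCover κ d))
    (hc : IsGrid κ δ c) (hc' : IsGrid (AddMonoidHom.id ℝ) δ c') [Nonempty (Fin d)] [Nontrivial A]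
    [Infinite B] (s : Finset ((Fin d → A) × (Fin d → B)))
    {f : (Fin d → A) × (Fin d → B) → (Fin d → A) × (Fin d → B)} (hf : InjOn f s) :
    ∃ (F : (Fin d → Y) × (Fin d → ℝ) → (Fin d → Y) × (Fin d → ℝ))
      (g : (Fin d → A) × (Fin d → B) → (Fin d → A) × (Fin d → B)),
      IsOrbitLimit (phaseCover κ d) r F ∧
      (∀ x, phaseCell c c' (F x) = g (phaseCell c c' x)) ∧ ∀ i ∈ s, g i = f i := by
  classical
  let R : Set ((Fin d → A) × (Fin d → B) → (Fin d → A) × (Fin d → B)) :=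
    {g | ∃ F, IsOrbitLimit (phaseCover κ d) r F ∧ ∀ x, phaseCell c c' (F x) = g (phaseCell c c' x)}
  have hR : ∀ g ∈ R, ∀ g' ∈ R, g ∘ g' ∈ R := by
    rintro g ⟨F, hF, e⟩ g' ⟨F', hF', e'⟩
    exact ⟨F ∘ F', hF.comp hmp hcomp hF', fun x => by simp only [Function.comp_apply, e, e']⟩
  obtain ⟨g, ⟨F, hF, e⟩, hg⟩ := exists_mem_eq_of_injOn hR
    (exists_isOrbitLimit_rowShift hr hmp hc hc') (exists_isOrbitLimit_columnShift hr hκ hmp hc hc')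
    s hf
  exact ⟨F, g, hF, e, hg⟩

end CellTranslation

/-! ### Rearrangement of nearly cellular functions -/

section Matching

theorem exists_injOn_mapsTo_of_card_eq {I : Type} {V U : Finset I} (h : V.card = U.card) :
    ∃ f : I → I, InjOn f V ∧ ∀ i ∈ V, f i ∈ U := by
  classical
  let e := Finset.equivOfCardEq h
  refine ⟨fun i => if hi : i ∈ V then e ⟨i, hi⟩ else i, fun i hi i' hi' he => ?_, fun i hi => ?_⟩
  · have hi : i ∈ V := hi
    have hi' : i' ∈ V := hi'
    simp only [hi, hi', dif_pos] at he
    exact congrArg Subtype.val (e.injective (Subtype.ext he))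
  · simp only [hi, dif_pos]
    exact (e ⟨i, hi⟩).2

open Classical in
/-- Two labellings of cells with finite supports can be matched, label by label, as far as the
numbers of cells allow. -/
theorem exists_matching {I : Type} (w₀ w₁ : I → ℤ) (E₀ E₁ : Finset I) :
    ∃ (s : Finset I) (f : I → I), InjOn f s ∧ (∀ i ∈ s, w₀ (f i) = w₁ i) ∧
      ∀ j, (s.filter fun i => w₁ i = j).card
        = min (E₀.filter fun i => w₀ i = j).card (E₁.filter fun i => w₁ i = j).card := by
  have hV : ∀ j, ∃ V ⊆ E₁.filter fun i => w₁ i = j, V.card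
      = min (E₀.filter fun i => w₀ i = j).card (E₁.filter fun i => w₁ i = j).card :=
    fun j => Finset.exists_subset_card_eq (min_le_right _ _)
  have hU : ∀ j, ∃ U ⊆ E₀.filter fun i => w₀ i = j, U.card
      = min (E₀.filter fun i => w₀ i = j).card (E₁.filter fun i => w₁ i = j).card :=
    fun j => Finset.exists_subset_card_eq (min_le_left _ _)
  choose V hV hVc using hV
  choose U hU hUc using hU
  choose f hf hfU using fun j => exists_injOn_mapsTo_of_card_eq ((hVc j).trans (hUc j).symm)
  set s := E₁.filter fun i => i ∈ V (w₁ i) with hs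
  have hlab : ∀ i ∈ s, w₀ (f (w₁ i) i) = w₁ i := fun i hi =>
    (Finset.mem_filter.1 (hU _ (hfU _ i (Finset.mem_filter.1 hi).2))).2
  refine ⟨s, fun i => f (w₁ i) i, fun i hi i' hi' he => ?_, hlab, fun j => ?_⟩
  · have e : w₁ i = w₁ i' := by
      rw [← hlab i hi, ← hlab i' hi']; exact congrArg w₀ he
    have h1 : i ∈ V (w₁ i) := (Finset.mem_filter.1 hi).2
    have h2 : i' ∈ V (w₁ i) := by rw [e]; exact (Finset.mem_filter.1 hi').2
    refine hf (w₁ i) h1 h2 ?_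
    have he : f (w₁ i) i = f (w₁ i') i' := he
    rw [he, e]
  · rw [← hVc j]
    congr 1
    ext i
    rw [Finset.mem_filter, hs, Finset.mem_filter]
    constructor
    · rintro ⟨⟨-, h⟩, rfl⟩; exact h
    · intro h
      obtain ⟨h1, rfl⟩ := Finset.mem_filter.1 (hV j h)
      exact ⟨⟨h1, h⟩, rfl⟩

end Matching

section Labels

variable {X I : Type} [MeasureSpace X]

theorem volume_preimage_finset {c : X → I} (hc : ∀ i, MeasurableSet (c ⁻¹' {i})) {m : ℝ≥0∞}
    (hm : ∀ i, volume (c ⁻¹' {i}) = m) (T : Finset I) :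
    volume (c ⁻¹' T) = T.card * m := by
  have : c ⁻¹' (T : Set I) = ⋃ i ∈ T, c ⁻¹' {i} := by ext x; simp
  rw [this, measure_biUnion_finset (fun i _ j _ hij => ?_) fun i _ => hc i]
  · simp [hm]
  · exact Disjoint.preimage c (by simpa using hij)

theorem finite_support_of_volume_lt_top {c : X → I} (hc : ∀ i, MeasurableSet (c ⁻¹' {i}))
    {m : ℝ≥0∞} (hm0 : m ≠ 0) (hm : ∀ i, volume (c ⁻¹' {i}) = m) {w : I → ℤ}
    (hw : volume {x | w (c x) ≠ 0} ≠ ⊤) : {i | w i ≠ 0}.Finite := by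
  classical
  have h := Measure.finite_const_le_meas_of_disjoint_iUnion (volume : Measure X)
    (ε := m) (pos_iff_ne_zero.2 hm0) (As := fun i => if w i ≠ 0 then c ⁻¹' {i} else ∅)
    (fun i => by split_ifs; exacts [hc i, MeasurableSet.empty]) (fun i j hij => ?_) ?_
  · refine h.subset fun i hi => ?_
    have hi : w i ≠ 0 := hi
    simp [hi, hm]
  · refine Disjoint.mono (b := c ⁻¹' {i}) (d := c ⁻¹' {j}) ?_ ?_
      (Disjoint.preimage c (by simpa using hij))
    · dsimp only; split_ifs <;> simp
    · dsimp only; split_ifs <;> simp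
  · refine ne_top_of_le_ne_top hw (measure_mono (iUnion_subset fun i x hx => ?_))
    by_cases hi : w i ≠ 0
    · simp only [hi, ne_eq, not_false_eq_true, if_true] at hx
      have hx : c x = i := hx
      change w (c x) ≠ 0
      rwa [hx]
    · simp [hi] at hx

/-- A bounded integer valued function that vanishes outside a set of finite volume is, up to small
volume, constant on the cells of every sufficiently fine partition. -/
theorem exists_label_of_fine [PseudoMetricSpace X] [BorelSpace X] [ProperSpace X]
    [SecondCountableTopology X] [IsFiniteMeasureOnCompacts (volume : Measure X)]
    {g : X → ℤ} (hg : Measurable g) {K : ℤ} (hK0 : 0 ≤ K) (hK : ∀ x, |g x| ≤ K)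
    (hfin : volume {x | g x ≠ 0} ≠ ⊤) {η : ℝ≥0∞} (hη : η ≠ 0) :
    ∃ δ₀ > 0, ∀ (I : Type) (c : X → I), (∀ x y, c x = c y → dist x y ≤ δ₀) →
      ∃ w : I → ℤ, (∀ i, |w i| ≤ K) ∧ volume {x | w (c x) ≠ g x} ≤ η := by
  have hint : Integrable (fun x => (g x : ℝ)) (volume : Measure X) := by
    have hm : Measurable fun x => (g x : ℝ) := measurable_from_top.comp hg
    have : MemLp (fun x => (g x : ℝ)) ⊤ (volume : Measure X) := by
      refine memLp_top_of_bound hm.aestronglyMeasurable K (Eventually.of_forall fun x => ?_)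
      rw [Real.norm_eq_abs]
      exact_mod_cast hK x
    refine memLp_one_iff_integrable.1 (this.mono_exponent_of_measure_support_ne_top
      (s := {x | g x ≠ 0}) (fun x hx => ?_) hfin le_top)
    have hx : g x = 0 := by simpa using hx
    simp [hx]
  -- a continuous function with compact support, hence uniformly continuous, is close to `g` in `L¹`
  obtain ⟨φ, hφs, hφ, hφc, -⟩ := hint.exists_hasCompactSupport_lintegral_sub_le
    (ε := ENNReal.ofReal (1 / 4) * η) (mul_ne_zero (by simp) hη)
  have hcheb : volume {x | ENNReal.ofReal (1 / 4) ≤ ‖(g x : ℝ) - φ x‖ₑ} ≤ η := by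
    have h := (mul_meas_ge_le_lintegral₀ (μ := volume)
      (hint.aestronglyMeasurable.sub hφc.aestronglyMeasurable).aemeasurable.enorm
      (ENNReal.ofReal (1 / 4))).trans hφ
    exact (ENNReal.mul_le_mul_iff_right (by simp) ENNReal.ofReal_ne_top).1 h
  obtain ⟨δ, hδ, hδφ⟩ := Metric.uniformContinuous_iff.1
    (hφs.uniformContinuous_of_continuous hφc) (1 / 4) (by norm_num)
  refine ⟨δ / 2, half_pos hδ, fun I c hc => ?_⟩
  rcases isEmpty_or_nonempty X with hX | hX
  · exact ⟨0, fun _ => by simpa using hK0, by simp [Set.eq_empty_of_isEmpty]⟩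
  let w : I → ℤ := fun i => round (φ (Function.invFun c i))
  refine ⟨fun i => if |w i| ≤ K then w i else 0, fun i => ?_, ?_⟩
  · dsimp only
    split_ifs with h
    · exact h
    · simpa using hK0
  · refine (measure_mono fun x hx => ?_).trans hcheb
    by_contra hlt
    -- the value of `φ` at the representative of the cell of `x` is within `1 / 2` of `g x`
    have h1 : |(g x : ℝ) - φ x| < 1 / 4 := by
      have hlt : ‖(g x : ℝ) - φ x‖ₑ < ENNReal.ofReal (1 / 4) := not_le.1 hlt
      rwa [← ofReal_norm, ENNReal.ofReal_lt_ofReal_iff (by norm_num), Real.norm_eq_abs] at hlt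
    have h2 : |φ (Function.invFun c (c x)) - φ x| < 1 / 4 := by
      have := hc _ x (Function.invFun_eq ⟨x, rfl⟩)
      exact hδφ (by linarith)
    have h3 : w (c x) = g x := by
      rw [abs_lt] at h1 h2
      exact round_eq_iff.2 ⟨by linarith, by linarith⟩
    refine hx ?_
    change (if |w (c x)| ≤ K then w (c x) else 0) = g x
    rw [h3, if_pos (hK x)]

/-- The volume of a fiber changes by at most the volume of the set where the function changes. -/
theorem volume_fiber_le_add {g g' : X → ℤ} {η : ℝ≥0∞} (h : volume {x | g x ≠ g' x} ≤ η) (j : ℤ) :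
    volume {x | g x = j} ≤ volume {x | g' x = j} + η := by
  refine (measure_mono fun x hx => ?_).trans ((measure_union_le {x | g' x = j} _).trans
    (add_le_add_right h _))
  by_cases e : g x = g' x
  · exact Or.inl (e.symm.trans hx)
  · exact Or.inr e

open Classical in
/-- If all injections of finite sets of cells are induced by members of `𝒞`, then two integer valued
functions with the same distribution, each of them nearly constant on cells, are nearly related by a
member of `𝒞`. -/
theorem exists_rearrangement {𝒞 : Set (X → X)} (h𝒞 : ∀ F ∈ 𝒞, MeasurePreserving F volume volume)
    {c : X → I} (hc : ∀ i, MeasurableSet (c ⁻¹' {i})) (hcm : ∀ W : Set I, MeasurableSet (c ⁻¹' W))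
    {m : ℝ≥0∞} (hm0 : m ≠ 0) (hmt : m ≠ ⊤)
    (hm : ∀ i, volume (c ⁻¹' {i}) = m)
    (hF : ∀ (s : Finset I) (f : I → I), InjOn f s →
      ∃ F ∈ 𝒞, ∃ g : I → I, (∀ x, c (F x) = g (c x)) ∧ ∀ i ∈ s, g i = f i)
    {g₀ g₁ : X → ℤ} (hg₀ : volume {x | g₀ x ≠ 0} ≠ ⊤) (hg₁ : volume {x | g₁ x ≠ 0} ≠ ⊤)
    (hg : ∀ j ≠ 0, volume {x | g₀ x = j} = volume {x | g₁ x = j}) (hg₀m : Measurable g₀)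
    {K : ℤ} {η : ℝ≥0∞} (hη : η ≠ ⊤) {w₀ w₁ : I → ℤ} (hw₀K : ∀ i, |w₀ i| ≤ K)
    (hw₁K : ∀ i, |w₁ i| ≤ K) (hw₀ : volume {x | w₀ (c x) ≠ g₀ x} ≤ η)
    (hw₁ : volume {x | w₁ (c x) ≠ g₁ x} ≤ η) :
    ∃ F ∈ 𝒞, volume {x | g₀ (F x) ≠ g₁ x} ≤ (2 + 4 * (Finset.Icc (-K) K).card) * η := by
  have hsupp : ∀ {w : I → ℤ} {g : X → ℤ}, volume {x | g x ≠ 0} ≠ ⊤ →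
      volume {x | w (c x) ≠ g x} ≤ η → {i | w i ≠ 0}.Finite := by
    intro w g hg hw
    refine finite_support_of_volume_lt_top hc hm0 hm (ne_top_of_le_ne_top
      (ENNReal.add_ne_top.2 ⟨hg, hη⟩) ((measure_mono fun x hx => ?_).trans
      ((measure_union_le {x | g x ≠ 0} _).trans (add_le_add_right hw _))))
    by_cases e : w (c x) = g x
    · exact Or.inl (by rw [mem_ofPred_eq, ← e]; exact hx)
    · exact Or.inr e
  have f₀ := hsupp hg₀ hw₀
  have f₁ := hsupp hg₁ hw₁
  obtain ⟨s, f, hinj, hsf, hcard⟩ := exists_matching w₀ w₁ f₀.toFinset f₁.toFinset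
  obtain ⟨F, hF𝒞, g, hFg, hgs⟩ := hF s f hinj
  have hFmp := h𝒞 F hF𝒞
  -- the label `j` is taken on `P j` by `w₁ ∘ c`, on `Q j` by `w₀ ∘ c ∘ F`, and on `S j` by both
  set P : ℤ → Set X := fun j => {x | w₁ (c x) = j}
  set Q : ℤ → Set X := fun j => {x | w₀ (c (F x)) = j}
  set S : ℤ → Set X := fun j => c ⁻¹' (s.filter fun i => w₁ i = j : Finset I)
  have hPc : ∀ j ≠ 0, volume (P j) = (f₁.toFinset.filter fun i => w₁ i = j).card * m := by
    intro j hj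
    rw [← volume_preimage_finset hc hm]
    congr 1
    ext x
    have : w₁ (c x) = j → w₁ (c x) ≠ 0 := fun h => h ▸ hj
    simpa [P] using this
  have hQc : ∀ j ≠ 0, volume (Q j) = (f₀.toFinset.filter fun i => w₀ i = j).card * m := by
    intro j hj
    rw [← volume_preimage_finset hc hm, ← hFmp.measure_preimage (hcm _).nullMeasurableSet]
    congr 1
    ext x
    have : w₀ (c (F x)) = j → w₀ (c (F x)) ≠ 0 := fun h => h ▸ hj
    simpa [Q] using this
  have hSc : ∀ j ≠ 0, volume (S j) = min (volume (Q j)) (volume (P j)) := by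
    intro j hj
    rw [hPc j hj, hQc j hj, volume_preimage_finset hc hm, hcard j]
    have : Monotone fun k : ℕ => (k : ℝ≥0∞) * m := fun a b h => by dsimp only; gcongr
    exact this.map_min
  have hSt : ∀ j, volume (S j) ≠ ⊤ := fun j => by
    rw [volume_preimage_finset hc hm]; exact ENNReal.mul_ne_top (by simp) hmt
  have hSm : ∀ j, MeasurableSet (S j) := fun j => hcm _
  have hSP : ∀ j, S j ⊆ P j := fun j x hx => by
    have : c x ∈ s ∧ w₁ (c x) = j := by simpa [S] using hx
    exact this.2
  have hSQ : ∀ j, S j ⊆ Q j := fun j x hx => by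
    have hx : c x ∈ s ∧ w₁ (c x) = j := by simpa [S] using hx
    change w₀ (c (F x)) = j
    rw [hFg, hgs _ hx.1, hsf _ hx.1, hx.2]
  have hD₀ : volume {x | w₀ (c (F x)) ≠ g₀ (F x)} ≤ η := by
    rwa [← hFmp.measure_preimage] at hw₀
    have h1 : MeasurableSet {x | w₀ (c x) ≠ g₀ x} := by
      have : {x | w₀ (c x) ≠ g₀ x} = ⋃ j, c ⁻¹' {i | w₀ i ≠ j} ∩ g₀ ⁻¹' {j} := by
        ext x; simp
      rw [this]
      exact MeasurableSet.iUnion fun j => (hcm _).inter (hg₀m (measurableSet_singleton j))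
    exact h1.nullMeasurableSet
  have hQg : ∀ j, volume {x | g₀ (F x) = j} = volume {x | g₀ x = j} := fun j =>
    hFmp.measure_preimage (s := {x | g₀ x = j})
      (hg₀m (measurableSet_singleton j)).nullMeasurableSet
  have hPQ : ∀ j ≠ 0, volume (P j) ≤ volume (Q j) + 2 * η := by
    intro j hj
    have h1 := volume_fiber_le_add hw₁ j
    have h2 := volume_fiber_le_add (g := fun x => g₀ (F x)) (g' := fun x => w₀ (c (F x)))
      (by simpa only [ne_comm] using hD₀) j
    rw [hQg, hg j hj] at h2
    calc volume (P j) ≤ volume {x | g₁ x = j} + η := h1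
      _ ≤ (volume (Q j) + η) + η := add_le_add_left h2 _
      _ = volume (Q j) + 2 * η := by ring
  have hQP : ∀ j ≠ 0, volume (Q j) ≤ volume (P j) + 2 * η := by
    intro j hj
    have h1 := volume_fiber_le_add (g := fun x => w₀ (c (F x))) hD₀ j
    have h2 := volume_fiber_le_add (g := g₁) (g' := fun x => w₁ (c x))
      (by simpa only [ne_comm] using hw₁) j
    rw [hQg, hg j hj] at h1
    calc volume (Q j) ≤ volume {x | g₁ x = j} + η := h1
      _ ≤ (volume (P j) + η) + η := add_le_add_left h2 _
      _ = volume (P j) + 2 * η := by ring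
  have hdiff : ∀ j ≠ 0, volume (P j \ S j) ≤ 2 * η ∧ volume (Q j \ S j) ≤ 2 * η := by
    intro j hj
    rw [measure_sdiff (hSP j) (hSm j).nullMeasurableSet (hSt j),
      measure_sdiff (hSQ j) (hSm j).nullMeasurableSet (hSt j), tsub_le_iff_left, tsub_le_iff_left,
      hSc j hj]
    rcases le_total (volume (Q j)) (volume (P j)) with h | h
    · rw [min_eq_left h]
      exact ⟨hPQ j hj, le_self_add⟩
    · rw [min_eq_right h]
      exact ⟨le_self_add, hQP j hj⟩
  refine ⟨F, hF𝒞, ?_⟩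
  -- the label `0` needs no count of its own: where the labels differ, one of them is not `0`
  set J := (Finset.Icc (-K) K).filter fun j => j ≠ 0
  have hcover : {x | g₀ (F x) ≠ g₁ x} ⊆ ({x | w₀ (c (F x)) ≠ g₀ (F x)} ∪ {x | w₁ (c x) ≠ g₁ x})
      ∪ ⋃ j ∈ J, (P j \ S j ∪ Q j \ S j) := by
    intro x hx
    by_cases e₀ : w₀ (c (F x)) = g₀ (F x)
    swap
    · exact Or.inl (Or.inl e₀)
    by_cases e₁ : w₁ (c x) = g₁ x
    swap
    · exact Or.inl (Or.inr e₁)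
    have hne : w₀ (c (F x)) ≠ w₁ (c x) := by rw [e₀, e₁]; exact hx
    right
    simp only [mem_iUnion]
    by_cases hz : w₁ (c x) = 0
    · have hz' : w₀ (c (F x)) ≠ 0 := by rwa [hz] at hne
      refine ⟨w₀ (c (F x)), Finset.mem_filter.2 ⟨Finset.mem_Icc.2 (abs_le.1 (hw₀K _)), hz'⟩,
        Or.inr ⟨rfl, fun hS => ?_⟩⟩
      have : w₁ (c x) = w₀ (c (F x)) := hSP _ hS
      exact hne this.symm
    · refine ⟨w₁ (c x), Finset.mem_filter.2 ⟨Finset.mem_Icc.2 (abs_le.1 (hw₁K _)), hz⟩,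
        Or.inl ⟨rfl, fun hS => hne (hSQ _ hS)⟩⟩
  calc volume {x | g₀ (F x) ≠ g₁ x}
      ≤ (η + η) + ∑ j ∈ J, (2 * η + 2 * η) := by
        refine (measure_mono hcover).trans ((measure_union_le _ _).trans (add_le_add
          ((measure_union_le _ _).trans (add_le_add hD₀ hw₁))
          ((measure_biUnion_finset_le _ _).trans (Finset.sum_le_sum fun j hj => ?_))))
        have hj := hdiff j (Finset.mem_filter.1 hj).2
        exact (measure_union_le _ _).trans (add_le_add hj.1 hj.2)
    _ = (2 + 4 * J.card) * η := by
        rw [Finset.sum_const, nsmul_eq_mul]; ring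
    _ ≤ (2 + 4 * (Finset.Icc (-K) K).card) * η := by
        gcongr
        exact Finset.filter_subset _ _

end Labels

/-! ### Coverings and grids for the line and the circle -/

section Covers

/-- A one-dimensional covering with a fundamental domain induces a covering by `T*ℝᵈ`. -/
theorem isPhaseCover_phaseCover {Y : Type} [NormedAddCommGroup Y] [MeasureSpace Y]
    [SigmaFinite (volume : Measure Y)] {κ : ℝ →+ Y} (hκ : IsOpenQuotientMap κ)
    (hker : (κ.ker : Set ℝ).Countable) {D : Set ℝ} (hD : MeasurableSet D)
    (huniq : ∀ x, ∃! y, y ∈ D ∧ κ y = κ x)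
    (hmp : MeasurePreserving κ (volume.restrict D) volume) (d : ℕ) :
    IsPhaseCover (phaseCover κ d) {z | ∀ i, z.1 i ∈ D} := by
  have hset : {z : CotEuclidean d | ∀ i, z.1 i ∈ D} = (univ.pi fun _ => D) ×ˢ univ := by
    ext z; simp
  have hmem : ∀ z : CotEuclidean d, z ∈ (phaseCover κ d).ker ↔ (∀ i, z.1 i ∈ κ.ker) ∧ z.2 = 0 := by
    intro z
    rw [AddMonoidHom.mem_ker, phaseCover_apply, Prod.ext_iff]
    simp only [funext_iff, AddMonoidHom.mem_ker]
    rfl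
  refine ⟨?_, ?_, ?_, fun z => ?_, ?_⟩
  · exact (IsOpenQuotientMap.piMap fun _ : Fin d => hκ).prodMap .id
  · have := hker.to_subtype
    refine (countable_range fun f : Fin d → κ.ker =>
      ((fun i => (f i : ℝ), 0) : CotEuclidean d)).mono fun z hz => ?_
    obtain ⟨h1, h2⟩ := (hmem z).1 hz
    exact ⟨fun i => ⟨z.1 i, h1 i⟩, Prod.ext rfl h2.symm⟩
  · rw [hset]
    exact (MeasurableSet.univ_pi fun _ => hD).prod MeasurableSet.univ
  · choose y hy hyu using fun i => huniq (z.1 i)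
    refine ⟨⟨(y - z.1, 0), (hmem _).2 ⟨fun i => ?_, rfl⟩⟩, fun i => ?_, fun γ hγ => ?_⟩
    · simp [AddMonoidHom.mem_ker, (hy i).2]
    · change (y - z.1 + z.1) i ∈ D
      rw [sub_add_cancel]
      exact (hy i).1
    · obtain ⟨h1, h2⟩ := (hmem γ).1 γ.2
      refine Subtype.ext (Prod.ext (funext fun i => ?_) h2)
      have h3 := hyu i ((γ : CotEuclidean d).1 i + z.1 i)
        ⟨hγ i, by rw [map_add, AddMonoidHom.mem_ker.1 (h1 i), zero_add]⟩
      exact eq_sub_of_add_eq h3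
  · rw [hset]
    have e : (volume : Measure (CotEuclidean d)).restrict ((univ.pi fun _ => D) ×ˢ univ)
        = (Measure.pi fun _ => volume.restrict D).prod volume := by
      rw [← Measure.restrict_pi_pi, Measure.volume_eq_prod, ← Measure.prod_restrict,
        Measure.restrict_univ]
      rfl
    rw [e]
    exact (measurePreserving_pi _ _ fun _ => hmp).prod (MeasurePreserving.id volume)

theorem isPhaseCover_id (d : ℕ) :
    IsPhaseCover (phaseCover (AddMonoidHom.id ℝ) d) {z | ∀ i, z.1 i ∈ (univ : Set ℝ)} := by
  refine isPhaseCover_phaseCover .id ?_ .univ (fun x => ⟨x, by simp, by simp⟩) ?_ d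
  · have : ((AddMonoidHom.id ℝ).ker : Set ℝ) = {0} := by ext; simp
    rw [this]; exact countable_singleton 0
  · rw [Measure.restrict_univ]; exact MeasurePreserving.id _

/-- The covering of the circle of length `2π` by the line. -/
abbrev circleCover : ℝ →+ AddCircle (2 * Real.pi) :=
  QuotientAddGroup.mk' (AddSubgroup.zmultiples (2 * Real.pi))

theorem circleCover_eq_iff {x y : ℝ} :
    circleCover x = circleCover y ↔ ∃ k : ℤ, x = y + k * (2 * Real.pi) := by
  rw [eq_comm, QuotientAddGroup.mk'_apply, QuotientAddGroup.mk'_apply, QuotientAddGroup.eq,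
    AddSubgroup.mem_zmultiples_iff]
  refine exists_congr fun k => ?_
  rw [zsmul_eq_mul]
  constructor <;> intro h <;> linarith

theorem isPhaseCover_circleCover (d : ℕ) :
    IsPhaseCover (phaseCover circleCover d) {z | ∀ i, z.1 i ∈ Ico 0 (2 * Real.pi)} := by
  refine isPhaseCover_phaseCover ?_ ?_ measurableSet_Ico (fun x => ?_) ?_ d
  · exact ⟨Quotient.mk_surjective, continuous_quotient_mk', QuotientAddGroup.isOpenMap_coe⟩
  · rw [QuotientAddGroup.ker_mk']
    exact countable_range _
  · refine ⟨toIcoMod Real.two_pi_pos 0 x, ⟨by simpa using toIcoMod_mem_Ico Real.two_pi_pos 0 x,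
      circleCover_eq_iff.2 ⟨-toIcoDiv Real.two_pi_pos 0 x, ?_⟩⟩, fun y hy => ?_⟩
    · rw [toIcoMod, zsmul_eq_mul]; push_cast; ring
    · obtain ⟨k, hk⟩ := circleCover_eq_iff.1 hy.2
      refine ((toIcoMod_eq_iff Real.two_pi_pos).2 ⟨by simpa using hy.1, -k, ?_⟩).symm
      rw [zsmul_eq_mul, hk]; push_cast; ring
  · have h := AddCircle.measurePreserving_mk (2 * Real.pi) 0
    rw [zero_add] at h
    rwa [Measure.restrict_congr_set Ico_ae_eq_Ioc]

end Covers

section Grids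

theorem floor_div_eq_iff {δ : ℝ} (hδ : 0 < δ) (x : ℝ) (a : ℤ) :
    ⌊x / δ⌋ = a ↔ a * δ ≤ x ∧ x < (a + 1) * δ := by
  rw [Int.floor_eq_iff, le_div_iff₀ hδ, div_lt_iff₀ hδ]

theorem isGrid_real {δ : ℝ} (hδ : 0 < δ) :
    IsGrid (AddMonoidHom.id ℝ) δ fun x : ℝ => ⌊x / δ⌋ := by
  have hIco : ∀ a : ℤ, (fun x : ℝ => ⌊x / δ⌋) ⁻¹' {a} = Ico (a * δ) ((a + 1) * δ) := by
    intro a; ext x; exact floor_div_eq_iff hδ x a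
  refine ⟨fun a => ?_, fun y y' h => ?_, fun a => ⟨a * δ, fun y => ?_⟩, fun a =>
    ⟨fun x => (x - a * δ) * ((a + 1) * δ - x), id,
      (by fun_prop : ContDiff ℝ ∞ fun x : ℝ => (x - a * δ) * ((a + 1) * δ - x)), contDiff_id,
      fun x hx => ⟨?_, ?_⟩, fun x hx h => ?_, ?_⟩, ENNReal.ofReal δ, by simpa using hδ,
      ENNReal.ofReal_ne_top, fun a => ?_⟩
  · rw [hIco]; exact measurableSet_Ico
  · have := (floor_div_eq_iff hδ y _).1 rfl
    have := (floor_div_eq_iff hδ y' _).1 h.symm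
    rw [Real.dist_eq, abs_le]
    constructor <;> linarith
  · simp only [AddMonoidHom.id_apply]
    rw [add_div, mul_div_cancel_right₀ _ hδ.ne', Int.floor_add_intCast]
  · have hx : 0 < (x - a * δ) * ((a + 1) * δ - x) := hx
    refine (floor_div_eq_iff hδ x a).2 ?_
    constructor <;> nlinarith
  · exact deriv_id x
  · have hx : (x - a * δ) * ((a + 1) * δ - x) < 0 := hx
    have := (floor_div_eq_iff hδ x a).1 h
    nlinarith [mul_nonneg (sub_nonneg.2 this.1) (sub_nonneg.2 this.2.le)]
  · refine measure_mono_null (t := {a * δ, (a + 1) * δ}) (fun x hx => ?_)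
      (((countable_singleton _).insert _).measure_zero _)
    rcases mul_eq_zero.1 hx with h | h
    · exact Or.inl (sub_eq_zero.1 h)
    · exact Or.inr (sub_eq_zero.1 h).symm
  · rw [hIco, Real.volume_Ico]
    congr 1; ring

/-- The division of the circle of length `2π` into `N` arcs of length `2π / N`. -/
def circleCell (N : ℕ) [NeZero N] : AddCircle (2 * Real.pi) → ZMod N :=
  Function.Periodic.lift (f := fun x : ℝ => ((⌊x / (2 * Real.pi / N)⌋ : ℤ) : ZMod N)) (by
    intro x
    have hN : (N : ℝ) ≠ 0 := NeZero.ne _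
    have : (x + 2 * Real.pi) / (2 * Real.pi / N) = x / (2 * Real.pi / N) + (N : ℤ) := by
      field_simp
      push_cast
      ring
    dsimp only
    rw [this, Int.floor_add_intCast]
    simp)

theorem circleCell_circleCover (N : ℕ) [NeZero N] (x : ℝ) :
    circleCell N (circleCover x) = ((⌊x / (2 * Real.pi / N)⌋ : ℤ) : ZMod N) := rfl

theorem circleCell_circleCover_eq_iff {N : ℕ} [NeZero N] (x : ℝ) (k : ℤ) :
    circleCell N (circleCover x) = (k : ZMod N) ↔
      ∃ n : ℤ, ⌊(x + n * (2 * Real.pi)) / (2 * Real.pi / N)⌋ = k := by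
  have hN : (N : ℝ) ≠ 0 := NeZero.ne _
  have h : ∀ n : ℤ, (x + n * (2 * Real.pi)) / (2 * Real.pi / N)
      = x / (2 * Real.pi / N) + ((n * N : ℤ) : ℝ) := by
    intro n
    field_simp
    push_cast
    ring
  simp only [h, Int.floor_add_intCast, circleCell_circleCover]
  rw [ZMod.intCast_eq_intCast_iff_dvd_sub]
  constructor
  · rintro ⟨n, hn⟩
    exact ⟨n, by linarith⟩
  · rintro ⟨n, hn⟩
    exact ⟨n, by linarith⟩

/-- A smooth `2π`-periodic function which is equal to `u` for `|u| ≤ π / 3`. -/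
def periodicCoordinate (u : ℝ) : ℝ :=
  Real.smoothTransition (4 * Real.cos u - 1) * Real.arcsin (Real.sin u)

theorem contDiff_periodicCoordinate : ContDiff ℝ ∞ periodicCoordinate := by
  rw [contDiff_iff_contDiffAt]
  intro u
  rcases lt_or_ge 0 (Real.cos u) with h | h
  · have h1 : Real.sin u ≠ -1 := fun e => by
      have := Real.sin_sq_add_cos_sq u; rw [e] at this; nlinarith
    have h2 : Real.sin u ≠ 1 := fun e => by
      have := Real.sin_sq_add_cos_sq u; rw [e] at this; nlinarith
    refine ContDiffAt.mul ?_ ?_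
    · exact (Real.smoothTransition.contDiff.comp
        ((contDiff_const.mul Real.contDiff_cos).sub contDiff_const)).contDiffAt
    · exact (Real.contDiffAt_arcsin h1 h2).comp u Real.contDiff_sin.contDiffAt
  · have : periodicCoordinate =ᶠ[𝓝 u] fun _ => 0 := by
      have : ∀ᶠ v in 𝓝 u, Real.cos v < 1 / 4 :=
        Real.continuous_cos.continuousAt.eventually_lt_const (by linarith)
      filter_upwards [this] with v hv
      rw [periodicCoordinate, Real.smoothTransition.zero_of_nonpos (by linarith), zero_mul]
    exact contDiffAt_const.congr_of_eventuallyEq this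

theorem deriv_periodicCoordinate {u : ℝ} (hu : 1 / 2 < Real.cos u) :
    deriv periodicCoordinate u = 1 := by
  have e : periodicCoordinate =ᶠ[𝓝 u] fun v => Real.arcsin (Real.sin v) := by
    filter_upwards [Real.continuous_cos.continuousAt.eventually_const_lt hu] with v hv
    rw [periodicCoordinate, Real.smoothTransition.one_of_one_le (by linarith), one_mul]
  have h1 : Real.sin u ≠ -1 := fun e => by
    have := Real.sin_sq_add_cos_sq u; rw [e] at this; nlinarith
  have h2 : Real.sin u ≠ 1 := fun e => by
    have := Real.sin_sq_add_cos_sq u; rw [e] at this; nlinarith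
  rw [e.deriv_eq]
  have h := (Real.hasDerivAt_arcsin h1 h2).comp u (Real.hasDerivAt_sin u)
  have h3 : Real.sqrt (1 - Real.sin u ^ 2) = Real.cos u := by
    rw [← Real.cos_sq', Real.sqrt_sq (by linarith)]
  rw [h3, one_div, inv_mul_cancel₀ (by linarith)] at h
  exact h.deriv

theorem cos_lt_cos_iff_abs_lt {α : ℝ} (h0 : 0 ≤ α) (hα : α ≤ Real.pi) {u : ℝ} (hu : |u| ≤ Real.pi) :
    Real.cos α < Real.cos u ↔ |u| < α := by
  rw [← Real.cos_abs u]
  exact Real.strictAntiOn_cos.lt_iff_gt ⟨h0, hα⟩ ⟨abs_nonneg u, hu⟩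

/-- The arcs form a grid of the circle. Around the midpoint `θ` of an arc the cell is described by
`cos (x - θ) > cos (π / N)`, and `N ≥ 3` makes room for the periodic coordinate. -/
theorem isGrid_circle {N : ℕ} [NeZero N] (hN : 3 ≤ N) :
    IsGrid circleCover (2 * Real.pi / N) (circleCell N) := by
  have hN0 : (0 : ℝ) < N := by positivity
  have hN3 : (3 : ℝ) ≤ N := by exact_mod_cast hN
  set δ : ℝ := 2 * Real.pi / N with hδdef
  have hδ : 0 < δ := by positivity
  have hδ3 : δ / 2 ≤ Real.pi / 3 := by
    rw [hδdef, div_div, div_le_div_iff₀ (by positivity) (by norm_num)]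
    nlinarith [Real.pi_pos]
  have hsurj : Function.Surjective circleCover := Quotient.mk_surjective
  have hcosδ : 1 / 2 ≤ Real.cos (δ / 2) := by
    rw [← Real.cos_pi_div_three]
    exact Real.cos_le_cos_of_nonneg_of_le_pi (by positivity) (by linarith [Real.pi_pos]) hδ3
  have hmeas : ∀ a, MeasurableSet (circleCell N ⁻¹' {a}) := by
    intro a
    let _ : MeasurableSpace (ZMod N) := ⊤
    have h : Measurable (circleCell N) := by
      refine QuotientAddGroup.measurable_from_quotient.2 ?_
      exact (measurable_from_top (f := fun k : ℤ => (k : ZMod N))).comp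
        (Int.measurable_floor.comp (measurable_id.div_const _))
    exact h trivial
  have hshift : ∀ a : ZMod N, ∃ τ : ℝ, ∀ y,
      circleCell N (y + circleCover τ) = circleCell N y + a := by
    intro a
    obtain ⟨k, rfl⟩ := ZMod.intCast_surjective a
    refine ⟨k * δ, fun y => ?_⟩
    obtain ⟨x, rfl⟩ := hsurj y
    rw [← map_add, circleCell_circleCover, circleCell_circleCover, ← hδdef, add_div,
      mul_div_cancel_right₀ _ hδ.ne', Int.floor_add_intCast, Int.cast_add]
  have hvol : ∀ a : ZMod N, volume (circleCell N ⁻¹' {a}) = volume (circleCell N ⁻¹' {0}) := by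
    intro a
    obtain ⟨τ, hτ⟩ := hshift a
    rw [← measure_preimage_add_right volume (circleCover τ) (circleCell N ⁻¹' {a})]
    congr 1
    ext y
    change circleCell N (y + circleCover τ) = a ↔ circleCell N y = 0
    rw [hτ, add_eq_right]
  refine ⟨hmeas, fun y y' h => ?_, hshift, fun a => ?_, volume (circleCell N ⁻¹' {0}), ?_, ?_,
    fun a => ?_⟩
  · obtain ⟨x, rfl⟩ := hsurj y
    obtain ⟨x', rfl⟩ := hsurj y'
    rw [circleCell_circleCover N x', circleCell_circleCover_eq_iff] at h
    obtain ⟨n, hn⟩ := h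
    rw [← hδdef] at hn
    have e : circleCover x = circleCover (x + n * (2 * Real.pi)) :=
      circleCover_eq_iff.2 ⟨-n, by push_cast; ring⟩
    have h1 := (floor_div_eq_iff hδ _ _).1 hn
    have h2 := (floor_div_eq_iff hδ x' _).1 rfl
    rw [e, dist_eq_norm, ← map_sub]
    refine (QuotientAddGroup.norm_mk_le_norm).trans ?_
    rw [Real.norm_eq_abs, abs_le]
    constructor <;> linarith
  · obtain ⟨k, rfl⟩ := ZMod.intCast_surjective a
    set θ : ℝ := (k + 1 / 2) * δ with hθ
    have hper : ∀ (x : ℝ) (n : ℤ),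
        Real.cos (x + n * (2 * Real.pi) - θ) = Real.cos (x - θ) := fun x n => by
      rw [add_sub_right_comm, Real.cos_add_int_mul_two_pi]
    have hcell : ∀ x (n : ℤ), ⌊(x + n * (2 * Real.pi)) / δ⌋ = k ↔
        -(δ / 2) ≤ x + n * (2 * Real.pi) - θ ∧ x + n * (2 * Real.pi) - θ < δ / 2 := by
      intro x n
      rw [floor_div_eq_iff hδ, hθ]
      constructor <;> rintro ⟨h1, h2⟩ <;> constructor <;> linarith
    have p1 : Function.Periodic (fun x : ℝ => Real.cos (x - θ) - Real.cos (δ / 2))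
        (2 * Real.pi) := by
      intro x
      have := hper x 1
      simp only [Int.cast_one, one_mul] at this
      simp only [this]
    have p2 : Function.Periodic (fun x : ℝ => periodicCoordinate (x - θ)) (2 * Real.pi) := by
      intro x
      have h1 : x + 2 * Real.pi - θ = x - θ + 2 * Real.pi := by ring
      simp only [periodicCoordinate, h1, Real.cos_add_two_pi, Real.sin_add_two_pi]
    have e1 : ∀ x : ℝ, p1.lift (circleCover x) = Real.cos (x - θ) - Real.cos (δ / 2) := fun _ => rfl
    have e2 : ∀ x : ℝ, p2.lift (circleCover x) = periodicCoordinate (x - θ) := fun _ => rfl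
    refine ⟨p1.lift, p2.lift, ?_, ?_, fun x hx => ⟨?_, ?_⟩, fun x hx h => ?_, ?_⟩
    · simp only [e1]; fun_prop
    · simp only [e2]
      exact contDiff_periodicCoordinate.comp (contDiff_id.sub contDiff_const)
    · rw [e1, sub_pos] at hx
      -- shift `x - θ` by a multiple of `2π` into `[-π, π]`
      rw [circleCell_circleCover_eq_iff]
      set n : ℤ := -round ((x - θ) / (2 * Real.pi)) with hn
      have hab : |x + n * (2 * Real.pi) - θ| ≤ Real.pi := by
        have h1 := abs_sub_round ((x - θ) / (2 * Real.pi))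
        have h2 : x + n * (2 * Real.pi) - θ
            = ((x - θ) / (2 * Real.pi) - round ((x - θ) / (2 * Real.pi))) * (2 * Real.pi) := by
          rw [hn, sub_mul, div_mul_cancel₀ _ Real.two_pi_pos.ne']
          push_cast
          ring
        rw [h2, abs_mul, abs_of_pos Real.two_pi_pos]
        nlinarith [Real.pi_pos]
      rw [← hper x n, cos_lt_cos_iff_abs_lt (by positivity) (by linarith [Real.pi_pos]) hab,
        abs_lt] at hx
      exact ⟨n, (hcell x n).2 ⟨hx.1.le, hx.2⟩⟩
    · rw [e1, sub_pos] at hx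
      simp only [e2]
      rw [deriv_comp_sub_const, deriv_periodicCoordinate (by linarith)]
    · rw [e1, sub_neg] at hx
      rw [circleCell_circleCover_eq_iff] at h
      obtain ⟨n, hn⟩ := h
      obtain ⟨h1, h2⟩ := (hcell x n).1 hn
      rw [← hper x n, ← Real.cos_abs (x + n * (2 * Real.pi) - θ)] at hx
      have h3 : |x + n * (2 * Real.pi) - θ| ≤ δ / 2 := abs_le.2 ⟨h1, h2.le⟩
      exact absurd hx (not_lt.2 (Real.cos_le_cos_of_nonneg_of_le_pi (abs_nonneg _)
        (by linarith [Real.pi_pos]) h3))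
    · have hm : Measurable p1.lift := by
        refine QuotientAddGroup.measurable_from_quotient.2 ?_
        change Measurable fun x : ℝ => Real.cos (x - θ) - Real.cos (δ / 2)
        fun_prop
      have h1 := (AddCircle.measurePreserving_mk (2 * Real.pi) 0).measure_preimage
        (hm (measurableSet_singleton 0)).nullMeasurableSet
      change volume (p1.lift ⁻¹' {0}) = 0
      rw [← h1]
      refine measure_mono_null (t := range (fun n : ℤ => 2 * n * Real.pi + δ / 2 + θ)
        ∪ range fun n : ℤ => 2 * n * Real.pi - δ / 2 + θ) (fun x hx => ?_)
        (((countable_range _).union (countable_range _)).measure_zero _)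
      have hx : Real.cos (x - θ) - Real.cos (δ / 2) = 0 := hx
      obtain ⟨n, hn | hn⟩ := Real.cos_eq_cos_iff.1 (sub_eq_zero.1 hx).symm
      · exact Or.inl ⟨n, by linarith⟩
      · exact Or.inr ⟨n, by linarith⟩
  · intro h0
    have h1 : (univ : Set (AddCircle (2 * Real.pi))) = ⋃ a : ZMod N, circleCell N ⁻¹' {a} := by
      ext; simp
    have h2 : volume (univ : Set (AddCircle (2 * Real.pi))) = 0 := by
      rw [h1]
      exact measure_iUnion_null fun a => (hvol a).trans h0
    rw [AddCircle.measure_univ, ENNReal.ofReal_eq_zero] at h2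
    linarith [Real.two_pi_pos]
  · exact measure_ne_top _ _
  · exact hvol a

end Grids

/-! ### Quantization -/

/-- Rounding to the nearest multiple of `1 / n`, truncated to the interval `[-n, n]` and multiplied
by `n` so as to be integer-valued. -/
def quantize (n : ℕ) (x : ℝ) : ℤ :=
  round (max (-(n : ℝ) ^ 2) (min ((n : ℝ) ^ 2) (n * x)))

theorem measurable_quantize (n : ℕ) : Measurable (quantize n) := by
  unfold quantize
  simp only [round_eq]
  fun_prop

theorem abs_clamp_le {a t : ℝ} (ha : 0 ≤ a) :
    |max (-a) (min a t)| ≤ a ∧ |max (-a) (min a t)| ≤ |t| := by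
  constructor
  · exact abs_le.2 ⟨le_max_left _ _, max_le (by linarith) (min_le_left _ _)⟩
  · rcases abs_cases t with ⟨h, h'⟩ | ⟨h, h'⟩ <;> rw [h, abs_le] <;> constructor <;>
      simp only [le_max_iff, le_min_iff, max_le_iff, min_le_iff] <;> grind

theorem abs_quantize_le (n : ℕ) (x : ℝ) : |quantize n x| ≤ (n : ℤ) ^ 2 + 1 := by
  have h1 := (abs_clamp_le (t := n * x) (sq_nonneg (n : ℝ))).1
  have h2 := abs_sub_round (max (-(n : ℝ) ^ 2) (min ((n : ℝ) ^ 2) (n * x)))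
  have : |(quantize n x : ℝ)| ≤ (n : ℝ) ^ 2 + 1 := by
    unfold quantize
    rw [abs_le] at *
    constructor <;> linarith [h1.1, h1.2, h2.1, h2.2]
  exact_mod_cast this

theorem abs_quantize_le_two_mul (n : ℕ) (x : ℝ) : |(quantize n x : ℝ)| ≤ 2 * (n * |x|) := by
  have h1 := (abs_clamp_le (t := n * x) (sq_nonneg (n : ℝ))).2
  have h2 := round_le (max (-(n : ℝ) ^ 2) (min ((n : ℝ) ^ 2) (n * x))) 0
  rw [abs_mul, Nat.abs_cast] at h1
  have h3 := abs_sub_abs_le_abs_sub (quantize n x : ℝ)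
    (max (-(n : ℝ) ^ 2) (min ((n : ℝ) ^ 2) (n * x)))
  rw [abs_sub_comm] at h3
  simp only [Int.cast_zero, sub_zero] at h2
  unfold quantize at *
  linarith

theorem lt_abs_of_quantize_ne_zero {n : ℕ} {x : ℝ} (h : quantize n x ≠ 0) : 1 / (4 * n) < |x| := by
  have h1 : (1 : ℝ) ≤ |(quantize n x : ℝ)| := by exact_mod_cast Int.one_le_abs h
  have h2 := abs_quantize_le_two_mul n x
  have hn : (0 : ℝ) < n := by
    rcases Nat.eq_zero_or_pos n with rfl | hn
    · norm_num at h2; norm_num [h2] at h1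
    · exact_mod_cast hn
  rw [div_lt_iff₀ (by positivity)]
  nlinarith [abs_nonneg x]

theorem tendsto_quantize_div (x : ℝ) :
    Tendsto (fun n : ℕ => (quantize n x : ℝ) / n) atTop (𝓝 x) := by
  have h0 : Tendsto (fun n : ℕ => 1 / (n : ℝ)) atTop (𝓝 0) := tendsto_one_div_atTop_nhds_zero_nat
  rw [tendsto_iff_dist_tendsto_zero]
  refine squeeze_zero' (.of_forall fun _ => dist_nonneg) ?_ h0
  filter_upwards [eventually_ge_atTop (max 1 ⌈|x|⌉₊)] with n hn
  have h1 : (1 : ℝ) ≤ n := by exact_mod_cast (le_max_left _ _).trans hn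
  have hx : |x| ≤ n := (Nat.le_ceil _).trans (by exact_mod_cast (le_max_right _ _).trans hn)
  rw [abs_le] at hx
  have hc : max (-(n : ℝ) ^ 2) (min ((n : ℝ) ^ 2) (n * x)) = n * x := by
    rw [min_eq_right (by nlinarith), max_eq_right (by nlinarith)]
  have h2 := abs_sub_round ((n : ℝ) * x)
  rw [Real.dist_eq, quantize, hc, abs_sub_comm, show x - (round ((n : ℝ) * x) : ℝ) / n =
    (n * x - round ((n : ℝ) * x)) / n by field_simp, abs_div, Nat.abs_cast]
  gcongr
  linarith

/-- The quantization of an `Lʳ` function converges to it in `Lʳ`. -/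
theorem tendsto_eLpNorm_quantize {X : Type} [MeasureSpace X] {r : ℝ≥0∞} (hr0 : r ≠ 0) (hr : r ≠ ⊤)
    {ρ : X → ℝ} (hρ : MemLp ρ r volume) :
    Tendsto (fun n : ℕ => eLpNorm (fun x => (quantize n (ρ x) : ℝ) / n - ρ x) r volume) atTop
      (𝓝 0) := by
  have hpos : 0 < r.toReal := ENNReal.toReal_pos hr0 hr
  have hm (n : ℕ) : AEStronglyMeasurable (fun x => (quantize n (ρ x) : ℝ) / n - ρ x) volume := by
    have : Measurable fun y : ℝ => (quantize n y : ℝ) / n - y :=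
      ((measurable_of_countable (fun z : ℤ => (z : ℝ))).comp (measurable_quantize n)).div_const _
        |>.sub measurable_id
    exact (this.comp_aemeasurable hρ.1.aemeasurable).aestronglyMeasurable
  have key : Tendsto (fun n : ℕ => ∫⁻ x, ‖(quantize n (ρ x) : ℝ) / n - ρ x‖ₑ ^ r.toReal) atTop
      (𝓝 (∫⁻ _ : X, 0)) := by
    refine tendsto_lintegral_of_dominated_convergence' (fun x => ‖3 * ρ x‖ₑ ^ r.toReal)
      (fun n => (hm n).enorm.pow_const _) (fun n => .of_forall fun x => ?_) ?_
      (.of_forall fun x => ?_)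
    · refine ENNReal.rpow_le_rpow ?_ hpos.le
      rw [enorm_le_iff_norm_le, Real.norm_eq_abs, Real.norm_eq_abs, abs_mul]
      have h2 := abs_quantize_le_two_mul n (ρ x)
      have h3 : |(quantize n (ρ x) : ℝ) / n| ≤ 2 * |ρ x| := by
        rw [abs_div, Nat.abs_cast]
        exact div_le_of_le_mul₀ (by positivity) (by positivity) (by linarith)
      have := abs_sub ((quantize n (ρ x) : ℝ) / n) (ρ x)
      norm_num
      linarith
    · exact (lintegral_rpow_enorm_lt_top_of_eLpNorm_lt_top hr0 hr (hρ.const_mul 3).2).ne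
    · have h := (tendsto_quantize_div (ρ x)).sub_const (ρ x)
      rw [sub_self] at h
      have h' := (ENNReal.continuous_rpow_const (y := r.toReal)).tendsto _ |>.comp
        ((continuous_enorm.tendsto _).comp h)
      simpa [Function.comp_def, ENNReal.zero_rpow_of_pos hpos] using h'
  simp only [lintegral_zero] at key
  have h' := ((ENNReal.continuous_rpow_const (y := 1 / r.toReal)).tendsto _).comp key
  rw [ENNReal.zero_rpow_of_pos (by positivity)] at h'
  exact h'.congr fun n => (eLpNorm_eq_lintegral_rpow_enorm_toReal hr0 hr).symm

/-- Equimeasurable `Lʳ` functions have the same distribution away from `0`, where their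
distributions are finite. -/
theorem Equimeasurable.volume_preimage_eq {X : Type} [MeasureSpace X] {r : ℝ≥0∞} (hr0 : r ≠ 0)
    (hr : r ≠ ⊤) {f g : X → ℝ} (h : Equimeasurable f g) (hf : MemLp f r volume)
    (hg : MemLp g r volume) (hfm : Measurable f) (hgm : Measurable g) {ε : ℝ} (hε : 0 < ε)
    {S : Set ℝ} (hS : MeasurableSet S) (hSε : ∀ x ∈ S, ε < |x|) :
    volume (f ⁻¹' S) = volume (g ⁻¹' S) := by
  have hA : MeasurableSet {x : ℝ | ε < |x|} := measurableSet_lt measurable_const measurable_id.abs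
  have hfin {f : X → ℝ} (hf : MemLp f r volume) (hfm : Measurable f) :
      IsFiniteMeasure ((volume.map f).restrict {x : ℝ | ε < |x|}) := by
    refine ⟨?_⟩
    rw [Measure.restrict_apply_univ, Measure.map_apply hfm hA]
    refine (measure_mono fun x hx => ?_).trans_lt
      (hf.meas_ge_lt_top hr0 hr (ε := ⟨ε, hε.le⟩) fun h => hε.ne' (congrArg NNReal.toReal h))
    have hx : ε < |f x| := hx
    exact hx.le
  have hIoo {f : X → ℝ} (hfm : Measurable f) (a b : ℝ) :
      ((volume.map f).restrict {x : ℝ | ε < |x|}) (Ioo a b) =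
        volume (f ⁻¹' Ioo (max a ε) b) + volume (f ⁻¹' Ioo a (min b (-ε))) := by
    rw [Measure.restrict_apply measurableSet_Ioo,
      Measure.map_apply hfm (measurableSet_Ioo.inter hA),
      ← measure_union _ (hfm measurableSet_Ioo), ← preimage_union]
    · congr 2
      ext x
      simp only [mem_inter_iff, mem_Ioo, mem_ofPred_eq, lt_abs, mem_union, max_lt_iff, lt_min_iff]
      grind
    · refine Disjoint.preimage _ (Set.disjoint_left.2 fun x hx hx' => ?_)
      simp only [mem_Ioo, max_lt_iff, lt_min_iff] at hx hx'
      linarith [hx.1.2, hx'.2.2]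
  have heq (a b : ℝ) : volume (f ⁻¹' Ioo a b) = volume (g ⁻¹' Ioo a b) := by
    rcases lt_or_ge a b with hab | hab
    · exact h a b hab
    · simp [hab]
  have := hfin hf hfm
  have := hfin hg hgm
  have hμ : (volume.map f).restrict {x : ℝ | ε < |x|} = (volume.map g).restrict {x | ε < |x|} :=
    Real.measure_ext_Ioo_rat fun a b => by rw [hIoo hfm, hIoo hgm, heq, heq]
  have := congrArg (fun m => m S) hμ
  simpa only [Measure.restrict_apply hS, inter_eq_left.2 (show S ⊆ {x | ε < |x|} from hSε),
    Measure.map_apply hfm hS, Measure.map_apply hgm hS] using this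

/-! ### Cells of phase space -/

theorem phaseCell_preimage_singleton {A B Y : Type} {d : ℕ} (c : Y → A) (c' : ℝ → B)
    (i : (Fin d → A) × (Fin d → B)) :
    phaseCell c c' ⁻¹' {i} =
      (univ.pi fun k => c ⁻¹' {i.1 k}) ×ˢ (univ.pi fun k => c' ⁻¹' {i.2 k}) := by
  ext x
  simp [phaseCell, Prod.ext_iff, funext_iff]

section PhaseCell

variable {A B Y : Type} [AddCommGroup A] [AddCommGroup B] [NormedAddCommGroup Y] [MeasureSpace Y]
  {d : ℕ} {κ : ℝ →+ Y} {δ : ℝ} {c : Y → A} {c' : ℝ → B}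

theorem measurableSet_phaseCell [Countable A] [Countable B] (hc : IsGrid κ δ c)
    (hc' : IsGrid (AddMonoidHom.id ℝ) δ c') (W : Set ((Fin d → A) × (Fin d → B))) :
    MeasurableSet (phaseCell c c' ⁻¹' W) := by
  rw [← biUnion_preimage_singleton]
  refine MeasurableSet.biUnion W.to_countable fun i _ => ?_
  rw [phaseCell_preimage_singleton]
  exact (MeasurableSet.univ_pi fun k => hc.measurableSet _).prod
    (MeasurableSet.univ_pi fun k => hc'.measurableSet _)

theorem exists_volume_phaseCell [SigmaFinite (volume : Measure Y)] (hc : IsGrid κ δ c)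
    (hc' : IsGrid (AddMonoidHom.id ℝ) δ c') :
    ∃ m : ℝ≥0∞, m ≠ 0 ∧ m ≠ ⊤ ∧ ∀ i : (Fin d → A) × (Fin d → B),
      volume (phaseCell c c' ⁻¹' {i}) = m := by
  obtain ⟨m, hm0, hmt, hm⟩ := hc.exists_volume
  obtain ⟨m', hm0', hmt', hm'⟩ := hc'.exists_volume
  refine ⟨m ^ d * m' ^ d, mul_ne_zero (pow_ne_zero _ hm0) (pow_ne_zero _ hm0'),
    ENNReal.mul_ne_top (ENNReal.pow_ne_top hmt) (ENNReal.pow_ne_top hmt'), fun i => ?_⟩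
  rw [phaseCell_preimage_singleton, Measure.volume_eq_prod, Measure.prod_prod, volume_pi, volume_pi,
    Measure.pi_pi, Measure.pi_pi]
  simp [hm, hm']

theorem dist_le_of_phaseCell_eq (hδ : 0 ≤ δ) (hc : IsGrid κ δ c)
    (hc' : IsGrid (AddMonoidHom.id ℝ) δ c') (x y : (Fin d → Y) × (Fin d → ℝ))
    (h : phaseCell c c' x = phaseCell c c' y) : dist x y ≤ δ := by
  simp only [phaseCell, Prod.mk.injEq, funext_iff] at h
  exact max_le ((dist_pi_le_iff hδ).2 fun i => hc.dist_le _ _ (h.1 i))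
    ((dist_pi_le_iff hδ).2 fun i => hc'.dist_le _ _ (h.2 i))

end PhaseCell

/-! ### The closure of an orbit -/

/-- In dimension zero the phase space is a point, on which equimeasurable functions are equal. -/
theorem eq_of_equimeasurable_of_isEmpty {Y : Type} [MeasureSpace Y]
    {d : ℕ} [IsEmpty (Fin d)] {r : ℝ≥0∞}
    {ρ₀ ρ₁ : Lp ℝ r (volume : Measure ((Fin d → Y) × (Fin d → ℝ)))} (h : Equimeasurable ρ₁ ρ₀) :
    ρ₁ = ρ₀ := by
  refine Lp.ext ?_
  let x₀ : (Fin d → Y) × (Fin d → ℝ) := (isEmptyElim, isEmptyElim)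
  by_cases e : ρ₁ x₀ = ρ₀ x₀
  · exact .of_forall fun x => by rw [Subsingleton.elim x x₀, e]
  · have h' := h (ρ₁ x₀ - |ρ₁ x₀ - ρ₀ x₀|) (ρ₁ x₀ + |ρ₁ x₀ - ρ₀ x₀|)
      (by linarith [abs_pos.2 (sub_ne_zero.2 e)])
    have h1 : {x | ρ₁ x₀ - |ρ₁ x₀ - ρ₀ x₀| < ρ₁ x ∧ ρ₁ x < ρ₁ x₀ + |ρ₁ x₀ - ρ₀ x₀|} = univ :=
      eq_univ_of_forall fun x => by
        rw [Subsingleton.elim x x₀]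
        have := abs_pos.2 (sub_ne_zero.2 e)
        exact ⟨by linarith, by linarith⟩
    have h2 : {x | ρ₁ x₀ - |ρ₁ x₀ - ρ₀ x₀| < ρ₀ x ∧ ρ₀ x < ρ₁ x₀ + |ρ₁ x₀ - ρ₀ x₀|} = ∅ :=
      eq_empty_of_forall_notMem fun x => by
        rw [Subsingleton.elim x x₀]
        rintro ⟨h1, h2⟩
        rcases abs_cases (ρ₁ x₀ - ρ₀ x₀) with ⟨h3, _⟩ | ⟨h3, _⟩ <;> linarith
    rw [h1, h2, measure_empty] at h'
    exact measure_mono_null (subset_univ _) h'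

section Closure

variable {Y : Type} [NormedAddCommGroup Y] [MeasureSpace Y] [BorelSpace Y] [ProperSpace Y]
  [SigmaFinite (volume : Measure Y)] [IsLocallyFiniteMeasure (volume : Measure Y)]
  [(volume : Measure Y).IsAddLeftInvariant] {κ : ℝ →+ Y} {d : ℕ} {r : ℝ≥0∞} [Fact (1 ≤ r)]

/-- If `κ : ℝ → Y` admits arbitrarily fine grids, the orbit of `ρ₀` is dense among the functions
that are equimeasurable with it. -/
theorem mem_closure_orbit_of_equimeasurable [Nonempty (Fin d)] (hr : r ≠ ⊤)
    (hκ : Function.Surjective κ)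
    (hmp : ∀ Φ ∈ DHam (phaseCover κ d), MeasurePreserving Φ volume volume)
    (hcomp : ∀ Φ ∈ DHam (phaseCover κ d), ∀ Ψ ∈ DHam (phaseCover κ d),
      Φ ∘ Ψ ∈ DHam (phaseCover κ d))
    (hgrid : ∀ ε > 0, ∃ δ, 0 < δ ∧ δ ≤ ε ∧ ∃ (A : Type) (_ : AddCommGroup A) (_ : Countable A)
      (_ : Nontrivial A) (c : Y → A), IsGrid κ δ c)
    {ρ₀ ρ₁ : Lp ℝ r (volume : Measure ((Fin d → Y) × (Fin d → ℝ)))} (h : Equimeasurable ρ₁ ρ₀) :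
    ρ₁ ∈ closure (orbit (phaseCover κ d) ρ₀) := by
  have hr0 : r ≠ 0 := (zero_lt_one.trans_le (Fact.out : 1 ≤ r)).ne'
  have hm (ρ : Lp ℝ r (volume : Measure ((Fin d → Y) × (Fin d → ℝ)))) : Measurable ρ :=
    (Lp.stronglyMeasurable ρ).measurable
  rw [← closure_closure, EMetric.mem_closure_iff]
  intro ε hε
  obtain ⟨ε', hε'0, hε'⟩ : ∃ ε' : ℝ≥0∞, 0 < ε' ∧ ε' + ε' + ε' < ε := by
    obtain ⟨a, ha, ha'⟩ := exists_between hε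
    refine ⟨a / 3, ENNReal.div_pos ha.ne' (by simp), ?_⟩
    rwa [ENNReal.add_thirds]
  -- at the level `n` of quantization both functions are approximated up to `ε'`
  obtain ⟨n, hn1, hn₀, hn₁⟩ := ((eventually_ge_atTop 1).and
    (((tendsto_order.1 (tendsto_eLpNorm_quantize hr0 hr (Lp.memLp ρ₀))).2 ε' hε'0).and
    ((tendsto_order.1 (tendsto_eLpNorm_quantize hr0 hr (Lp.memLp ρ₁))).2 ε' hε'0))).exists
  have hn : (0 : ℝ) < n := by exact_mod_cast hn1
  set K : ℤ := (n : ℤ) ^ 2 + 1 with hK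
  have hK0 : 0 ≤ K := by positivity
  -- where the quantized functions differ, they differ by at most `2 * K / n`; a set of volume `η`
  -- is small enough for this to cost only `ε'`
  obtain ⟨η, hη0, hη⟩ := exists_eLpNorm_indicator_le
    (μ := (volume : Measure ((Fin d → Y) × (Fin d → ℝ)))) hr (2 * (K : ℝ) / n) hε'0.ne'
  set η' : ℝ≥0∞ := η / (2 + 4 * (Finset.Icc (-K) K).card) with hη'
  have hcard0 : (2 + 4 * (Finset.Icc (-K) K).card : ℝ≥0∞) ≠ 0 := by simp
  have hcardt : (2 + 4 * (Finset.Icc (-K) K).card : ℝ≥0∞) ≠ ⊤ := by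
    exact_mod_cast ENNReal.natCast_ne_top (2 + 4 * (Finset.Icc (-K) K).card)
  have hη'0 : η' ≠ 0 := (ENNReal.div_pos (by exact_mod_cast hη0.ne') hcardt).ne'
  have hη't : η' ≠ ⊤ := ENNReal.div_ne_top ENNReal.coe_ne_top hcard0
  have hfin (ρ : Lp ℝ r (volume : Measure ((Fin d → Y) × (Fin d → ℝ)))) :
      volume {x | quantize n (ρ x) ≠ 0} ≠ ⊤ := by
    refine ((measure_mono fun x hx => ?_).trans_lt ((Lp.memLp ρ).meas_ge_lt_top hr0 hr
      (ε := ⟨1 / (4 * n), by positivity⟩) fun h => ?_)).ne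
    · exact (lt_abs_of_quantize_ne_zero hx).le
    · have h' : 1 / (4 * (n : ℝ)) = 0 := congrArg NNReal.toReal h
      exact absurd h' (by positivity)
  have hgm (ρ : Lp ℝ r (volume : Measure ((Fin d → Y) × (Fin d → ℝ)))) :
      Measurable fun x => quantize n (ρ x) := (measurable_quantize n).comp (hm ρ)
  have hdist (j : ℤ) (hj : j ≠ 0) :
      volume {x | quantize n (ρ₀ x) = j} = volume {x | quantize n (ρ₁ x) = j} :=
    (h.volume_preimage_eq hr0 hr (Lp.memLp ρ₁) (Lp.memLp ρ₀) (hm ρ₁) (hm ρ₀)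
      (ε := 1 / (4 * n)) (by positivity) (measurable_quantize n (measurableSet_singleton j))
      fun x (hx : quantize n x = j) => lt_abs_of_quantize_ne_zero (hx ▸ hj)).symm
  obtain ⟨δ₀, hδ₀, hl₀⟩ := exists_label_of_fine (hgm ρ₀) hK0 (fun x => abs_quantize_le n _)
    (hfin ρ₀) hη'0
  obtain ⟨δ₁, hδ₁, hl₁⟩ := exists_label_of_fine (hgm ρ₁) hK0 (fun x => abs_quantize_le n _)
    (hfin ρ₁) hη'0
  -- a grid so fine that both quantized functions are nearly constant on its cells
  obtain ⟨δ, hδ, hδle, A, _, _, _, c, hc⟩ := hgrid (min δ₀ δ₁) (lt_min hδ₀ hδ₁)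
  have hc' := isGrid_real hδ
  have hdle := dist_le_of_phaseCell_eq (d := d) hδ.le hc hc'
  obtain ⟨w₀, hw₀K, hw₀⟩ := hl₀ _ _ fun x y e => (hdle x y e).trans (hδle.trans (min_le_left _ _))
  obtain ⟨w₁, hw₁K, hw₁⟩ := hl₁ _ _ fun x y e => (hdle x y e).trans (hδle.trans (min_le_right _ _))
  obtain ⟨m, hm0, hmt, hcell⟩ := exists_volume_phaseCell (d := d) hc hc'
  obtain ⟨F, ⟨hF, hFcl⟩, hFη⟩ := exists_rearrangement
    (𝒞 := {F | IsOrbitLimit (phaseCover κ d) r F}) (fun F hF => hF.1)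
    (fun i => measurableSet_phaseCell hc hc' {i}) (measurableSet_phaseCell hc hc') hm0 hmt hcell
    (fun s f hf => by
      obtain ⟨F, g, hF, e⟩ := exists_isOrbitLimit_of_injOn hr hκ hmp hcomp hc hc' s hf
      exact ⟨F, hF, g, e⟩)
    (hfin ρ₀) (hfin ρ₁) hdist (hgm ρ₀) hη't hw₀K hw₁K hw₀ hw₁
  rw [hη', ENNReal.mul_div_cancel hcard0 hcardt] at hFη
  refine ⟨_, hFcl ρ₀, lt_of_le_of_lt ?_ hε'⟩
  rw [edist_comm, Lp.edist_def]
  have hcast : Measurable fun z : ℤ => (z : ℝ) := measurable_of_countable _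
  have hq (ρ : Lp ℝ r (volume : Measure ((Fin d → Y) × (Fin d → ℝ)))) :
      Measurable fun x => (quantize n (ρ x) : ℝ) / n := (hcast.comp (hgm ρ)).div_const _
  set a : (Fin d → Y) × (Fin d → ℝ) → ℝ := fun x => (quantize n (ρ₀ x) : ℝ) / n - ρ₀ x with ha
  set b : (Fin d → Y) × (Fin d → ℝ) → ℝ := fun x => (quantize n (ρ₁ x) : ℝ) / n - ρ₁ x with hb
  set e : (Fin d → Y) × (Fin d → ℝ) → ℝ :=
    fun x => (quantize n (ρ₀ (F x)) : ℝ) / n - (quantize n (ρ₁ x) : ℝ) / n with he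
  have hsplit : (⇑(Lp.compMeasurePreserving F hF ρ₀) - ⇑ρ₁ : (Fin d → Y) × (Fin d → ℝ) → ℝ)
      =ᵐ[volume] e - a ∘ F + b := by
    filter_upwards [Lp.coeFn_compMeasurePreserving ρ₀ hF] with x hx
    simp only [Pi.sub_apply, Pi.add_apply, Function.comp_apply, ha, hb, he, hx]
    ring
  have ham : AEStronglyMeasurable a volume := ((hq ρ₀).sub (hm ρ₀)).aestronglyMeasurable
  have hem : AEStronglyMeasurable e volume :=
    (((hq ρ₀).comp hF.measurable).sub (hq ρ₁)).aestronglyMeasurable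
  have hbm : AEStronglyMeasurable b volume := ((hq ρ₁).sub (hm ρ₁)).aestronglyMeasurable
  have haF : AEStronglyMeasurable (a ∘ F) volume := ham.comp_measurePreserving hF
  have hebound : eLpNorm e r volume ≤ ε' := by
    refine (eLpNorm_mono_real (g := ({x | quantize n (ρ₀ (F x)) ≠ quantize n (ρ₁ x)}).indicator
      fun _ => 2 * (K : ℝ) / n) fun x => ?_).trans (hη _ hFη)
    by_cases hx : quantize n (ρ₀ (F x)) = quantize n (ρ₁ x)
    · simp [he, hx]
    · rw [indicator_of_mem (show x ∈ {x | quantize n (ρ₀ (F x)) ≠ quantize n (ρ₁ x)} from hx)]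
      have h0 : |(quantize n (ρ₀ (F x)) : ℝ)| ≤ K := by exact_mod_cast abs_quantize_le n (ρ₀ (F x))
      have h1 : |(quantize n (ρ₁ x) : ℝ)| ≤ K := by exact_mod_cast abs_quantize_le n (ρ₁ x)
      simp only [he]
      rw [Real.norm_eq_abs, ← sub_div, abs_div, Nat.abs_cast]
      gcongr
      linarith [abs_sub (quantize n (ρ₀ (F x)) : ℝ) (quantize n (ρ₁ x))]
  rw [eLpNorm_congr_ae hsplit]
  refine (eLpNorm_add_le (hem.sub haF) hbm Fact.out).trans (add_le_add ?_ hn₁.le)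
  refine (eLpNorm_sub_le hem haF Fact.out).trans (add_le_add hebound ?_)
  rw [eLpNorm_comp_measurePreserving ham hF]
  exact hn₀.le

/-- The closure of the orbit of `ρ₀` consists of the functions equimeasurable with `ρ₀`. -/
theorem closure_orbit_phaseCover {D : Set (CotEuclidean d)} (hD : IsPhaseCover (phaseCover κ d) D)
    (hr : r ≠ ⊤) (hκ : Function.Surjective κ)
    (hgrid : ∀ ε > 0, ∃ δ, 0 < δ ∧ δ ≤ ε ∧ ∃ (A : Type) (_ : AddCommGroup A) (_ : Countable A)
      (_ : Nontrivial A) (c : Y → A), IsGrid κ δ c)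
    (ρ₀ : Lp ℝ r (volume : Measure ((Fin d → Y) × (Fin d → ℝ)))) :
    closure (orbit (phaseCover κ d) ρ₀) =
      {ρ₁ : Lp ℝ r (volume : Measure ((Fin d → Y) × (Fin d → ℝ))) | Equimeasurable ρ₁ ρ₀} := by
  have hmp : ∀ Φ ∈ DHam (phaseCover κ d), MeasurePreserving Φ volume volume :=
    fun Φ hΦ => DHam.measurePreserving hD hΦ
  refine Subset.antisymm (fun ρ₁ h => equimeasurable_of_mem_closure_orbit hmp h) fun ρ₁ h => ?_
  rcases isEmpty_or_nonempty (Fin d) with hd | hd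
  · rw [eq_of_equimeasurable_of_isEmpty h]
    exact subset_closure ⟨_, qShear_mem_DHam (f := 0) contDiff_const,
      .of_forall fun x => congrArg ρ₀ (Subsingleton.elim _ _)⟩
  · exact mem_closure_orbit_of_equimeasurable hr hκ hmp
      (fun Φ hΦ Ψ hΨ => DHam.comp hD.countable_ker hΦ hΨ) hgrid h

end Closure

end

theorem theorem1p1 (d : ℕ) (r : ℝ≥0∞) [Fact (1 ≤ r)] (hr : r ≠ ⊤) :
    (∀ ρ₀ : Lp ℝ r (volume : Measure (CotEuclidean d)),
      closure (orbit (id : CotEuclidean d → CotEuclidean d) ρ₀) =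
        {ρ₁ : Lp ℝ r (volume : Measure (CotEuclidean d)) | ∀ μ ν : ℝ, μ < ν →
          volume {x | μ < ρ₁ x ∧ ρ₁ x < ν} = volume {x | μ < ρ₀ x ∧ ρ₀ x < ν}}) ∧
    (∀ ρ₀ : Lp ℝ r (volume : Measure (CotTorus d)),
      closure (orbit (torusCover d) ρ₀) =
        {ρ₁ : Lp ℝ r (volume : Measure (CotTorus d)) | ∀ μ ν : ℝ, μ < ν →
          volume {x | μ < ρ₁ x ∧ ρ₁ x < ν} = volume {x | μ < ρ₀ x ∧ ρ₀ x < ν}}) := by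
  constructor
  · exact closure_orbit_phaseCover (isPhaseCover_id d) hr Function.surjective_id
      fun ε hε => ⟨ε, hε, le_rfl, ℤ, inferInstance, inferInstance, inferInstance, _,
        isGrid_real hε⟩
  · refine closure_orbit_phaseCover (isPhaseCover_circleCover d) hr Quotient.mk_surjective
      fun ε hε => ?_
    obtain ⟨N, hN⟩ := exists_nat_ge (2 * Real.pi / ε)
    have h3 : 3 ≤ N + 3 := by omega
    have : Fact (1 < N + 3) := ⟨by omega⟩
    refine ⟨2 * Real.pi / (N + 3 : ℕ), by positivity, ?_, ZMod (N + 3), inferInstance,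
      inferInstance, inferInstance, _, isGrid_circle h3⟩
    rw [div_le_iff₀ (by positivity)]
    rw [div_le_iff₀ hε] at hN
    push_cast
    nlinarith
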